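/- **Definitions.** An election consists of a set $\mathcal C$ of $m\ge 2$ candidates, a set $\mathcal V$ of $n$ voters, a profile $P=(\succ_v)_{v\in\mathcal V}$ of linear orders on $\mathcal C$ (the votes), and a voting rule $r$ given by a scoring vector $\alpha\in\mathbb Q^m$ with $\alpha_1\ge\alpha_2\ge\dots\ge\alpha_m$ and $\alpha_1>\alpha_m$ together with a tie-breaking linear order $\succ_t$ on $\mathcal C$. A candidate receives $\alpha_i$ points from each vote in which it is ranked $i$-th; the winner $r(P)$ is the candidate of maximum total score, ties being broken in favour of the candidate ranked highest by $\succ_t$. Let $x=r(P)$. For a candidate $y\ne x$, a set $M\subseteq\mathcal V$ is a *coalition of possible manipulators against $y$* if the votes of the voters in $M$ can be replaced by linear orders, each ranking $x$ above $y$, such that $y$ is the winner of the resulting profile (the votes outside $M$ being unchanged). $M$ is a *coalition of possible manipulators* if it is one against some candidate $y\neq x$. * **CPMSW**: given an election (including the rule $r$, i.e. $\alpha$ and $\succ_t$), a candidate $y$ and an integer $k\ge 0$, decide whether there is $M\subseteq\mathcal V$ with $|M|\le k$ that is a coalition of possible manipulators against $y$. * **CPMS**: given an election (including the rule $r$) and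 an integer $k\ge 0$, decide whether there is $M\subseteq\mathcal V$ with $|M|\le k$ that is a coalition of possible manipulators. Instances are written as strings over a fixed finite alphabet: the candidates are numbered, all numbers are written in binary, the rational entries of $\alpha$ as numerator and denominator, and each vote and $\succ_t$ as the list of the candidates from best to worst. **Theorem.** Restricted to instances whose scoring vector satisfies $\alpha_1-\alpha_2\le\alpha_i-\alpha_{i+1}$ for all $1\le i\le m-1$, the problems CPMSW and CPMS are in $\mathsf P$: each of them is decided by a Turing machine that, on every such instance, halts with the correct answer within a number of steps polynomial in the length of the instance. -/

import Mathlib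

namespace Manipulation

/-! ### Elections and scoring rules -/

/-- A preference (linear order) over the candidates `Fin m`, given as the bijection that sends
each candidate to its position; position `0` is the most preferred one. -/
abbrev Preference (m : ℕ) : Type := Fin m ≃ Fin m

/-- `v.Prefers a b`: the preference `v` strictly prefers `a` to `b`. -/
def Preference.Prefers {m : ℕ} (v : Preference m) (a b : Fin m) : Prop := v a < v b

/-- A scoring vector `α₁ ≥ α₂ ≥ ⋯ ≥ αₘ` with `α₁ > αₘ` (positions are numbered from `0`). -/
structure ScoringVector (m : ℕ) where
  two_le : 2 ≤ m
  α : Fin m → ℚ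
  antitone : ∀ i j : Fin m, i ≤ j → α j ≤ α i
  last_lt_first : α ⟨m - 1, by omega⟩ < α ⟨0, by omega⟩

/-- The condition `α₁ - α₂ ≤ αᵢ - αᵢ₊₁` for all `i`. -/
def ScoringVector.FirstGapMinimal {m : ℕ} (s : ScoringVector m) : Prop :=
  ∀ (i : ℕ) (h : i + 1 < m),
    s.α ⟨0, by omega⟩ - s.α ⟨1, by omega⟩ ≤ s.α ⟨i, by omega⟩ - s.α ⟨i + 1, h⟩

section Rules

variable {m : ℕ} {V : Type} [Fintype V]

/-- The score of candidate `c` in the profile `P`. -/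
def ScoringVector.score (s : ScoringVector m) (P : V → Preference m) (c : Fin m) : ℚ :=
  ∑ v, s.α (P v c)

/-- The voting correspondence: the candidates with maximum score. -/
def ScoringVector.cowinners (s : ScoringVector m) (P : V → Preference m) : Finset (Fin m) :=
  Finset.univ.filter fun c => ∀ d, s.score P d ≤ s.score P c

theorem ScoringVector.cowinners_nonempty (s : ScoringVector m) (P : V → Preference m) :
    (s.cowinners P).Nonempty := by
  have hm := s.two_le
  have : Nonempty (Fin m) := ⟨⟨0, by omega⟩⟩
  obtain ⟨c, hc⟩ := Finite.exists_max (s.score P)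
  exact ⟨c, by simp [ScoringVector.cowinners, hc]⟩

/-- Lexicographic tie breaking: the candidate of `S` that the preference `t` likes most. -/
def tieBreak (t : Preference m) (S : Finset (Fin m)) (hS : S.Nonempty) : Fin m :=
  t.symm ((S.image t).min' (hS.image t))

/-- The voting rule given by a scoring vector and a tie-breaking order. -/
def ScoringVector.winner (s : ScoringVector m) (t : Preference m) (P : V → Preference m) : Fin m :=
  tieBreak t (s.cowinners P) (s.cowinners_nonempty P)

/-! ### Coalitions of possible manipulators -/

/-- `M` is a coalition of possible manipulators against `y` for the voting rule `r` and the
profile `P`: the candidate `y` is not the current winner `r P`, and the voters in `M` can be given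
new preferences, all of them preferring the current winner to `y`, such that `y` wins. -/
def IsCoalitionAgainst (r : (V → Preference m) → Fin m) (P : V → Preference m)
    (M : Finset V) (y : Fin m) : Prop :=
  y ≠ r P ∧ ∃ Q : V → Preference m,
    (∀ v, v ∉ M → Q v = P v) ∧ (∀ v, v ∈ M → (Q v).Prefers (r P) y) ∧ r Q = y

/-- `M` is a coalition of possible manipulators (against some candidate). -/
def IsCoalition (r : (V → Preference m) → Fin m) (P : V → Preference m) (M : Finset V) : Prop :=
  ∃ y, IsCoalitionAgainst r P M y

end Rules

/-! ### Input format

An input is a list of rows of integers, written over a five-letter alphabet. -/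

/-- The input alphabet. -/
inductive Letter : Type
  | bit (b : Bool)
  | minus
  | comma
  | bar
  deriving DecidableEq, Fintype

/-- An integer in signed binary notation (least significant bit first), ended by a comma. -/
def writeInt (z : ℤ) : List Letter :=
  (if z < 0 then [Letter.minus] else []) ++ z.natAbs.bits.map Letter.bit ++ [Letter.comma]

/-- A list of integers, ended by a bar. -/
def writeRow (l : List ℤ) : List Letter := l.flatMap writeInt ++ [Letter.bar]

/-- A list of rows. -/
def writeRows (L : List (List ℤ)) : List Letter := L.flatMap writeRow

/-- The candidates in the order of the preference `v`, the most preferred one first. -/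
def rowOfPreference {m : ℕ} (v : Preference m) : List ℤ :=
  List.ofFn fun p : Fin m => ((v.symm p : ℕ) : ℤ)

/-- The entries of a scoring vector, each one as numerator and denominator in lowest terms. -/
def rowOfScores {m : ℕ} (s : ScoringVector m) : List ℤ :=
  (List.ofFn s.α).flatMap fun q => [q.num, (q.den : ℤ)]

/-! ### The two decision problems -/

/-- An election: candidates `Fin m`, voters `Fin n`, a voting rule (a scoring vector and a
tie-breaking order), and the preference profile of the voters. -/
structure Election where
  m : ℕ
  n : ℕ
  scores : ScoringVector m
  tie : Preference m
  profile : Fin n → Preference m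

/-- The voting rule of an election. -/
def Election.rule (E : Election) : (Fin E.n → Preference E.m) → Fin E.m :=
  E.scores.winner E.tie

/-- The scoring vector, the tie-breaking order, and the votes. -/
def Election.rows (E : Election) : List (List ℤ) :=
  rowOfScores E.scores :: rowOfPreference E.tie ::
    List.ofFn fun i => rowOfPreference (E.profile i)

/-- An instance of CPMS, for scoring rules with `α₁ - α₂ ≤ αᵢ - αᵢ₊₁` for all `i`. -/
structure CPMSInstance where
  election : Election
  gap : election.scores.FirstGapMinimal
  k : ℕ

/-- An instance of CPMSW, for scoring rules with `α₁ - α₂ ≤ αᵢ - αᵢ₊₁` for all `i`. -/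
structure CPMSWInstance where
  election : Election
  gap : election.scores.FirstGapMinimal
  y : Fin election.m
  k : ℕ

/-- CPMS: is there a coalition of possible manipulators of size at most `k`? -/
def CPMS (I : CPMSInstance) : Prop :=
  ∃ M : Finset (Fin I.election.n), M.card ≤ I.k ∧
    IsCoalition I.election.rule I.election.profile M

/-- CPMSW: is there a coalition of possible manipulators against `y` of size at most `k`? -/
def CPMSW (I : CPMSWInstance) : Prop :=
  ∃ M : Finset (Fin I.election.n), M.card ≤ I.k ∧
    IsCoalitionAgainst I.election.rule I.election.profile M I.y

def CPMSInstance.write (I : CPMSInstance) : List Letter :=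
  writeRows ([(I.k : ℤ)] :: I.election.rows)

def CPMSWInstance.write (I : CPMSWInstance) : List Letter :=
  writeRows ([((I.y : ℕ) : ℤ), (I.k : ℤ)] :: I.election.rows)

/-! ### The input format is unambiguous -/

theorem append_sep_inj {Γ : Type} {c : Γ} {a b r r' : List Γ} (ha : c ∉ a) (hb : c ∉ b)
    (h : a ++ c :: r = b ++ c :: r') : a = b ∧ r = r' := by
  induction a generalizing b with
  | nil => cases b <;> simp_all
  | cons x a ih =>
    rw [List.mem_cons, not_or] at ha
    cases b with
    | nil =>
      simp only [List.cons_append, List.nil_append, List.cons.injEq] at h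
      exact absurd h.1.symm ha.1
    | cons y b =>
      rw [List.mem_cons, not_or] at hb
      simp only [List.cons_append, List.cons.injEq] at h
      obtain ⟨h1, h2⟩ := ih ha.2 hb.2 h.2
      exact ⟨by rw [h.1, h1], h2⟩

theorem natBits_injective : Function.Injective Nat.bits := fun a b h => by
  have h2 := congrArg (List.map fun b => cond b 1 0) h
  rw [← Nat.digits_two_eq_bits, ← Nat.digits_two_eq_bits] at h2
  exact Nat.digits.injective 2 h2

theorem writeInt_append_inj {z z' : ℤ} {r r' : List Letter}
    (h : writeInt z ++ r = writeInt z' ++ r') : z = z' ∧ r = r' := by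
  have bit_inj : Function.Injective Letter.bit := fun a b h => by simpa using h
  simp only [writeInt, List.append_assoc, List.singleton_append] at h
  rw [← List.append_assoc, ← List.append_assoc] at h
  have key := append_sep_inj (by split_ifs <;> simp) (by split_ifs <;> simp) h
  refine ⟨?_, key.2⟩
  have k := key.1
  have nb : ∀ (a b : List Bool), Letter.minus :: a.map Letter.bit ≠ b.map Letter.bit := by
    intro a b hab
    cases b <;> simp at hab
  split_ifs at k with h1 h2 h2
  · simp only [List.singleton_append, List.cons.injEq, true_and] at k
    have := natBits_injective (List.map_injective_iff.2 bit_inj k)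
    omega
  · exact absurd k (nb _ _)
  · exact absurd k.symm (nb _ _)
  · have := natBits_injective (List.map_injective_iff.2 bit_inj k)
    omega

/-- Concatenation of words from a code without prefixes is injective. -/
theorem flatMap_inj {X Γ : Type} {f : X → List Γ} (hne : ∀ x, f x ≠ [])
    (hf : ∀ {x x' : X} {r r' : List Γ}, f x ++ r = f x' ++ r' → x = x' ∧ r = r') :
    ∀ {l l' : List X}, l.flatMap f = l'.flatMap f → l = l'
  | [], [], _ => rfl
  | [], x :: l, h => by simp [List.flatMap_cons, hne] at h
  | x :: l, [], h => by simp [List.flatMap_cons, hne] at h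
  | x :: l, x' :: l', h => by
    simp only [List.flatMap_cons] at h
    obtain ⟨h1, h2⟩ := hf h
    rw [h1, flatMap_inj hne hf h2]

theorem writeRow_append_inj {l l' : List ℤ} {r r' : List Letter}
    (h : writeRow l ++ r = writeRow l' ++ r') : l = l' ∧ r = r' := by
  have nb : ∀ l : List ℤ, Letter.bar ∉ l.flatMap writeInt := by
    intro l hl
    obtain ⟨z, -, hz⟩ := List.mem_flatMap.1 hl
    simp only [writeInt] at hz
    split_ifs at hz <;> simp at hz
  simp only [writeRow, List.append_assoc, List.singleton_append] at h
  have key := append_sep_inj (nb _) (nb _) h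
  exact ⟨flatMap_inj (by simp [writeInt]) writeInt_append_inj key.1, key.2⟩

theorem writeRows_injective : Function.Injective writeRows := fun _ _ h =>
  flatMap_inj (by simp [writeRow]) writeRow_append_inj h

theorem rowOfPreference_injective {m : ℕ} :
    Function.Injective (rowOfPreference : Preference m → List ℤ) := fun v w h => by
  have h1 := List.ofFn_injective h
  have h2 : v.symm = w.symm := by
    ext p
    exact_mod_cast congrFun h1 p
  simpa using congrArg Equiv.symm h2

theorem length_rowOfPreference {m : ℕ} (v : Preference m) : (rowOfPreference v).length = m := by
  simp [rowOfPreference]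

theorem rowOfScores_injective {m : ℕ} :
    Function.Injective (rowOfScores : ScoringVector m → List ℤ) := fun s s' h => by
  have h1 : List.ofFn s.α = List.ofFn s'.α := by
    refine flatMap_inj (by simp) ?_ h
    intro q q' r r' e
    simp only [List.cons_append, List.nil_append, List.cons.injEq, Nat.cast_inj] at e
    exact ⟨Rat.ext e.1 e.2.1, e.2.2⟩
  have h2 := List.ofFn_injective h1
  cases s; cases s'; simp_all

theorem Election.rows_injective : Function.Injective Election.rows := by
  rintro ⟨m, n, s, t, P⟩ ⟨m', n', s', t', P'⟩ h
  simp only [Election.rows, List.cons.injEq] at h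
  obtain ⟨h1, h2, h3⟩ := h
  obtain rfl : m = m' := by
    simpa [length_rowOfPreference] using congrArg List.length h2
  obtain rfl : n = n' := by simpa using congrArg List.length h3
  obtain rfl := rowOfScores_injective h1
  obtain rfl := rowOfPreference_injective h2
  have h4 := List.ofFn_injective h3
  obtain rfl : P = P' := by
    funext i
    exact rowOfPreference_injective (congrFun h4 i)
  rfl

theorem CPMSInstance.write_injective : Function.Injective CPMSInstance.write := by
  rintro ⟨E, g, k⟩ ⟨E', g', k'⟩ h
  have h' := writeRows_injective h
  simp only [List.cons.injEq, Nat.cast_inj, and_true] at h'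
  obtain ⟨rfl, h2⟩ := h'
  obtain rfl := Election.rows_injective h2
  rfl

theorem CPMSWInstance.write_injective : Function.Injective CPMSWInstance.write := by
  rintro ⟨E, g, y, k⟩ ⟨E', g', y', k'⟩ h
  have h' := writeRows_injective h
  simp only [List.cons.injEq, Nat.cast_inj, and_true] at h'
  obtain ⟨⟨h1, rfl⟩, h2⟩ := h'
  obtain rfl := Election.rows_injective h2
  obtain rfl := Fin.ext h1
  rfl

noncomputable def cpmsEncoding : Computability.Encoding CPMSInstance Letter where
  encode := CPMSInstance.write
  decode := Function.partialInv CPMSInstance.write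
  decode_encode := Function.partialInv_left CPMSInstance.write_injective

noncomputable def cpmswEncoding : Computability.Encoding CPMSWInstance Letter where
  encode := CPMSWInstance.write
  decode := Function.partialInv CPMSWInstance.write
  decode_encode := Function.partialInv_left CPMSWInstance.write_injective

/-! ### The class P -/

open Classical in
/-- The decision problem `L`, with inputs encoded by `e`, is in P: some Turing machine, on every
encoded input, halts within a number of steps bounded by a polynomial in the length of the encoding
and outputs whether the input is in `L`. -/
def InP {X Γ : Type} (e : Computability.Encoding X Γ) (L : X → Prop) : Prop :=
  Nonempty (Turing.TM2ComputableInPolyTime e.encode Computability.encodeBool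
    fun x => decide (L x))

end Manipulation

/-! Let `x` be the winner and `y` a rival. A manipulator ranks `x` above `y`, so the vote gives `y`
at least `α₁ - α₂` points less than `x`: the two positions enclose some gap, and the first gap is
the smallest. Putting `x` first and `y` second attains this bound, and it can be done without
advancing any other candidate. Then `x` loses no points and nobody but `x` and `y` gains any, so `y`
beats everybody as soon as `y` beats `x`. Hence `M` is a coalition against `y` exactly when the
gains of its members add up to the deficit of `y` against `x`, strictly if tie-breaking favours `x`
(`ScoringVector.FirstGapMinimal.isCoalitionAgainst_iff`). The gains are independent of each other,
so only the largest sum of at most `k` of them matters.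

That maximum is computed without sorting, by duality: it is the minimum over `τ ≥ 0` of `k * τ + ∑
max (g - τ) 0`, attained at `τ = 0` or at one of the numbers themselves
(`exists_sum_iff_relaxation`). So the deficit is compared with this expression for each such
threshold (`canOvertake_iff`, `solveFor_iff`).

For the time bound, structured programs on three stacks are compiled to Turing machines, with one
machine step per loop test (`Prog.Runs.steps`). The functions `PT` computed by such programs in
polynomial time, with results of polynomial size, are closed under composition, pairing, case
distinction and, decisively, folding over a list whenever the intermediate results stay polynomially
bounded (`PT.foldl`). Binary arithmetic, unreduced fractions, the parser and the algorithm are all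
folds of this kind, and `inP_of_PT` turns a `PT` decision procedure into membership in P. -/

namespace Manipulation

open Turing

/-! ### A small programming language for stack machines -/

/-- The working stacks. -/
inductive Reg : Type
  | A | B | C
  deriving DecidableEq

instance : Fintype Reg := ⟨{.A, .B, .C}, fun r => by cases r <;> simp⟩

/-- The content of the variable and of the three stacks. -/
structure Store where
  v : Option Letter
  a : List Letter
  b : List Letter
  c : List Letter

def Store.get (s : Store) : Reg → List Letter
  | .A => s.a
  | .B => s.b
  | .C => s.c

def Store.set (s : Store) (r : Reg) (l : List Letter) : Store :=
  match r with
  | .A => { s with a := l }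
  | .B => { s with b := l }
  | .C => { s with c := l }

/-- Structured programs. -/
inductive Prog : Type
  | skip
  | push (r : Reg) (f : Option Letter → Letter)
  | pop (r : Reg)
  | seq (p q : Prog)
  | ite (c : Option Letter → Bool) (p q : Prog)
  | loop (c : Option Letter → Bool) (p : Prog)

namespace Prog

/-- `Runs p s s' t`: the program `p` transforms `s` into `s'`, testing loop conditions `t` times. -/
inductive Runs : Prog → Store → Store → ℕ → Prop
  | skip (s) : Runs skip s s 0
  | push (r f) (s : Store) : Runs (push r f) s (s.set r (f s.v :: s.get r)) 0
  | pop (r) (s : Store) :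
      Runs (pop r) s ({ s with v := (s.get r).head? }.set r (s.get r).tail) 0
  | seq {p q s s' s'' t t'} : Runs p s s' t → Runs q s' s'' t' → Runs (seq p q) s s'' (t + t')
  | ite_true {c p q t} {s s' : Store} : c s.v = true → Runs p s s' t → Runs (ite c p q) s s' t
  | ite_false {c p q t} {s s' : Store} : c s.v = false → Runs q s s' t → Runs (ite c p q) s s' t
  | loop_done {c p} {s : Store} : c s.v = false → Runs (loop c p) s s 1
  | loop_step {c p t t'} {s s' s'' : Store} : c s.v = true → Runs p s s' t →
      Runs (loop c p) s' s'' t' → Runs (loop c p) s s'' (1 + t + t')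

/-! ### Compilation to a Turing machine -/

/-- The alphabets of the stacks; the stack `none` is for the output. -/
abbrev Alphabet : Option Reg → Type
  | none => Bool
  | some _ => Letter

abbrev MStmt (Λ : Type) : Type := TM2.Stmt Alphabet Λ (Option Letter)

/-- The labels of a program, one for each loop. -/
def Lab : Prog → Type
  | seq p q => Lab p ⊕ Lab q
  | ite _ p q => Lab p ⊕ Lab q
  | loop _ p => Option (Lab p)
  | skip | push _ _ | pop _ => Empty

noncomputable instance fintypeLab : (p : Prog) → Fintype (Lab p)
  | seq p q => by
      have := fintypeLab p; have := fintypeLab q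
      exact inferInstanceAs (Fintype (Lab p ⊕ Lab q))
  | ite _ p q => by
      have := fintypeLab p; have := fintypeLab q
      exact inferInstanceAs (Fintype (Lab p ⊕ Lab q))
  | loop _ p => by
      have := fintypeLab p
      exact inferInstanceAs (Fintype (Option (Lab p)))
  | skip => inferInstanceAs (Fintype Empty)
  | push _ _ => inferInstanceAs (Fintype Empty)
  | pop _ => inferInstanceAs (Fintype Empty)

/-- The statement that runs `p` and goes on with `k`. -/
def entry {Λ : Type} : (p : Prog) → (Lab p → Λ) → MStmt Λ → MStmt Λ
  | skip, _, k => k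
  | push r f, _, k => TM2.Stmt.push (some r) f k
  | pop r, _, k => TM2.Stmt.pop (some r) (fun _ x => x) k
  | seq p q, e, k => entry p (fun l => e (Sum.inl l)) (entry q (fun l => e (Sum.inr l)) k)
  | ite c p q, e, k => TM2.Stmt.branch c (entry p (fun l => e (Sum.inl l)) k)
      (entry q (fun l => e (Sum.inr l)) k)
  -- The continuation is not lost: `code` attaches it to the exit branch at the label of the loop.
  | loop _ _, e, _ => TM2.Stmt.goto fun _ => e (none : Option _)

/-- The statements at the labels of `p`, when `p` is followed by `k`. -/
def code {Λ : Type} : (p : Prog) → (Lab p → Λ) → MStmt Λ → Lab p → MStmt Λ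
  | seq p q, e, k, Sum.inl l =>
      code p (fun l => e (Sum.inl l)) (entry q (fun l => e (Sum.inr l)) k) l
  | seq _ q, e, k, Sum.inr l => code q (fun l => e (Sum.inr l)) k l
  | ite _ p _, e, k, Sum.inl l => code p (fun l => e (Sum.inl l)) k l
  | ite _ _ q, e, k, Sum.inr l => code q (fun l => e (Sum.inr l)) k l
  | loop c p, e, k, (none : Option _) => TM2.Stmt.branch c
      (entry p (fun l => e (some l)) (TM2.Stmt.goto fun _ => e (none : Option _))) k
  | loop _ p, e, _, (some l : Option _) =>
      code p (fun l => e (some l)) (TM2.Stmt.goto fun _ => e (none : Option _)) l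

/-- The stacks of the machine. -/
def tapes (s : Store) (out : List Bool) : (k : Option Reg) → List (Alphabet k)
  | none => out
  | some r => s.get r

theorem update_tapes_some (s : Store) (out : List Bool) (r : Reg) (l : List Letter) :
    Function.update (tapes s out) (some r) l = tapes (s.set r l) out := by
  funext k
  rcases k with _ | k
  · exact Function.update_of_ne (by simp) _ _
  · by_cases h : k = r
    · subst h
      refine (Function.update_self _ _ _).trans ?_
      cases k <;> rfl
    · refine (Function.update_of_ne (by simpa using h) _ _).trans ?_
      cases r <;> cases k <;> first | rfl | exact absurd rfl h

/-- `t` steps of the machine. -/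
def Steps {Λ : Type} (m : Λ → MStmt Λ) (t : ℕ)
    (c c' : TM2.Cfg Alphabet Λ (Option Letter)) : Prop :=
  (flip bind (TM2.step m))^[t] (some c) = some c'

theorem Steps.trans {Λ : Type} {m : Λ → MStmt Λ} {t t' : ℕ} {c c' c''}
    (h : Steps m t c c') (h' : Steps m t' c' c'') : Steps m (t + t') c c'' := by
  unfold Steps at *
  rw [Nat.add_comm, Function.iterate_add_apply, h, h']

/-- A machine step executes a whole statement up to the next jump, and only loop tests are jump
targets. So pushes and pops are free and `t` counts machine steps exactly. -/
theorem Runs.steps {Λ : Type} {m : Λ → MStmt Λ} {p : Prog} {s s' : Store} {t : ℕ}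
    (h : Runs p s s' t) (out : List Bool) :
    ∀ (e : Lab p → Λ) (k : MStmt Λ), (∀ l, m (e l) = code p e k l) →
      Steps m t (TM2.stepAux (entry p e k) s.v (tapes s out))
        (TM2.stepAux k s'.v (tapes s' out)) := by
  induction h with
  | skip => intro e k _; rfl
  | push r f s =>
    intro e k _
    simp only [entry, TM2.stepAux, Steps, Function.iterate_zero, id]
    have : (s.set r (f s.v :: s.get r)).v = s.v := by cases r <;> rfl
    rw [this]
    erw [update_tapes_some]
    rfl
  | pop r s =>
    intro e k _
    have h1 : ({ s with v := (s.get r).head? }.set r (s.get r).tail).v = (s.get r).head? := by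
      cases r <;> rfl
    have h2 : ({ s with v := (s.get r).head? }.set r (s.get r).tail) =
      { s.set r (s.get r).tail with v := (s.get r).head? } := by
      cases r <;> rfl
    rw [h1]
    simp only [entry, TM2.stepAux, Steps, Function.iterate_zero, id]
    erw [update_tapes_some]
    rw [h2]
    rfl
  | seq _ _ ih1 ih2 =>
    intro e k hm
    exact (ih1 _ _ fun l => hm (Sum.inl l)).trans (ih2 _ _ fun l => hm (Sum.inr l))
  | ite_true hc _ ih =>
    intro e k hm
    simp only [entry, TM2.stepAux, hc, cond_true]
    exact ih _ _ fun l => hm (Sum.inl l)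
  | ite_false hc _ ih =>
    intro e k hm
    simp only [entry, TM2.stepAux, hc, cond_false]
    exact ih _ _ fun l => hm (Sum.inr l)
  | loop_done hc =>
    intro e k hm
    have := hm (none : Option _)
    simp [entry, Steps, flip, this, code, hc]
  | @loop_step c p t t' s s' s'' hc _ _ ih1 ih2 =>
    intro e k hm
    have h0 := hm (none : Option _)
    refine Steps.trans (Steps.trans (c' := TM2.stepAux (entry p (fun l => e (some l))
      (TM2.Stmt.goto fun _ => e (none : Option _))) s.v (tapes s out)) ?_ ?_) (ih2 e k hm)
    · simp [entry, Steps, flip, h0, code, hc]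
    · exact ih1 _ _ fun l => hm (some l : Option _)

/-- The last statement of the machine: it moves the answer to the output stack. -/
def finish (Λ : Type) : MStmt Λ :=
  TM2.Stmt.pop (some Reg.A) (fun _ x => x) <|
  TM2.Stmt.push none (fun v => (decide (v = some (Letter.bit true)) : Bool)) <|
  -- This removes the bar and resets the variable, because `haltList` demands empty working stacks
  -- and the initial state.
  TM2.Stmt.pop (some Reg.A) (fun _ _ => none) <|
  TM2.Stmt.halt

/-- The machine that runs the program `p`. -/
noncomputable def machine (p : Prog) : FinTM2 where
  K := Option Reg
  k₀ := some Reg.A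
  k₁ := none
  Γ := Alphabet
  Λ := Option (Lab p)
  main := none
  σ := Option Letter
  initialState := none
  Γk₀Fin := inferInstanceAs (Fintype Letter)
  m := fun l => match l with
    | none => entry p some (finish _)
    | some l => code p some (finish _) l

/-- The one additional step executes the statement at the start label; `finish` is part of the last
step. -/
theorem Runs.outputs {p : Prog} {l : List Letter} {v : Option Letter} {b : Bool} {t : ℕ}
    (h : Runs p ⟨none, l, [], []⟩ ⟨v, [Letter.bit b, Letter.bar], [], []⟩ t) :
    Nonempty (TM2OutputsInTime (machine p) l (some [b]) (t + 1)) := by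
  have h1 := h.steps (m := (machine p).m) [] some (finish _) (fun l => rfl)
  have h2 : Steps (machine p).m 1 (initList (machine p) l)
      (TM2.stepAux (entry p some (finish _)) none (tapes ⟨none, l, [], []⟩ [])) := by
    have : (initList (machine p) l) = ⟨some none, none, tapes ⟨none, l, [], []⟩ []⟩ := by
      unfold initList
      congr 1
      funext k
      rcases k with _ | k
      · rfl
      · cases k <;> rfl
    rw [this]
    rfl
  have h3 : TM2.stepAux (finish (Option (Lab p))) v
      (tapes ⟨v, [Letter.bit b, Letter.bar], [], []⟩ []) = haltList (machine p) [b] := by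
    unfold haltList
    simp only [finish, TM2.stepAux]
    congr 1
    funext k
    rcases k with _ | k
    · cases b <;> rfl
    · cases k <;> rfl
  have h4 := h2.trans h1
  erw [h3] at h4
  exact ⟨⟨⟨1 + t, h4⟩, (Nat.add_comm 1 t).le⟩⟩

end Prog

namespace Prog

/-! ### Programs for strings on stacks -/

theorem Runs.cast {p : Prog} {s s' s'' : Store} {t t' : ℕ} (h : Runs p s s' t) (hs : s' = s'')
    (ht : t = t') : Runs p s s'' t' := hs ▸ ht ▸ h

/-- `p` turns the stacks `a`, `b`, `c` into `a'`, `b'`, `c'` with at most `n` tests. -/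
def Exec (p : Prog) (a b c a' b' c' : List Letter) (n : ℕ) : Prop :=
  ∀ v, ∃ v' t, t ≤ n ∧ Runs p ⟨v, a, b, c⟩ ⟨v', a', b', c'⟩ t

theorem Exec.seq {p q : Prog} {a b c a' b' c' a'' b'' c'' : List Letter} {n n' : ℕ}
    (h : Exec p a b c a' b' c' n) (h' : Exec q a' b' c' a'' b'' c'' n') :
    Exec (p.seq q) a b c a'' b'' c'' (n + n') := fun v => by
  obtain ⟨v1, t, ht, r⟩ := h v
  obtain ⟨v2, t', ht', r'⟩ := h' v1
  exact ⟨v2, t + t', by omega, r.seq r'⟩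

theorem Exec.mono {p : Prog} {a b c a' b' c' : List Letter} {n n' : ℕ}
    (h : Exec p a b c a' b' c' n) (hn : n ≤ n') : Exec p a b c a' b' c' n' := fun v => by
  obtain ⟨v1, t, ht, r⟩ := h v
  exact ⟨v1, t, by omega, r⟩

/-- The string `w` on top of a stack `r`. -/
def str (w : List Bool) (r : List Letter) : List Letter := w.map Letter.bit ++ Letter.bar :: r

/-- The code of a pair of strings. -/
def penc (u w : List Bool) : List Bool := (u.flatMap fun x => [true, x]) ++ false :: w

/-- The first component is self-delimiting: each bit is announced by `true`, and `false` marks the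
end. This doubling is why nested codes need care in all size estimates. -/
theorem length_penc (u w : List Bool) : (penc u w).length = 2 * u.length + 1 + w.length := by
  simp [penc, List.length_flatMap]
  omega

def isBit : Option Letter → Bool
  | some (Letter.bit _) => true
  | _ => false

def isOne : Option Letter → Bool
  | some (Letter.bit true) => true
  | _ => false

/-- Push the variable. -/
def pushV (r : Reg) : Prog := push r fun v => v.getD Letter.bar

/-- Push a fixed letter. -/
def pushL (r : Reg) (l : Letter) : Prog := push r fun _ => l

/-- Read the string on top of `r`, and run `p` for each letter. -/
def scan (r : Reg) (p : Prog) : Prog := seq (pop r) (loop isBit (seq p (pop r)))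

/-- Move the string on top of `r` to `r'`, and reverse it. -/
def mv (r r' : Reg) : Prog := seq (pushL r' Letter.bar) (scan r (pushV r'))

/-- At each test the next letter has already been popped, so the invariant has the head of the
string in the variable and only its tail on the stack. -/
theorem mv_loop (r r' : Reg) (hr : r ≠ r') (w : List Bool) (s : Store) (l : List Letter)
    (hv : s.v = (str w l).head?) (hs : s.get r = (str w l).tail) :
    ∃ s', Runs (loop isBit (seq (pushV r') (pop r))) s s' (w.length + 1) ∧
      s' = ({ s with v := some Letter.bar }.set r l).set r'
        (w.reverse.map Letter.bit ++ s.get r') := by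
  induction w generalizing s with
  | nil =>
    refine ⟨s, Runs.loop_done (by rw [hv]; rfl), ?_⟩
    obtain ⟨v, a, b, c⟩ := s
    cases r <;> cases r' <;> simp_all [Store.set, Store.get, str]
  | cons x w ih =>
    have hv' : s.v = some (Letter.bit x) := by rw [hv]; rfl
    have hs' : s.get r = str w l := by rw [hs]; rfl
    obtain ⟨s', h1, h2⟩ := ih
      (({ s with v := (str w l).head? }.set r (str w l).tail).set r' (Letter.bit x :: s.get r'))
      (by cases r <;> cases r' <;> rfl)
      (by cases r <;> cases r' <;> first | rfl | exact absurd rfl hr)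
    have hp : Runs (pushV r') s (s.set r' (Letter.bit x :: s.get r')) 0 := by
      have := Runs.push r' (fun v => v.getD Letter.bar) s
      rwa [hv'] at this
    have hq := Runs.pop r (s.set r' (Letter.bit x :: s.get r'))
    have he : (s.set r' (Letter.bit x :: s.get r')).get r = str w l := by
      rw [← hs']
      cases r <;> cases r' <;> first | rfl | exact absurd rfl hr
    rw [he] at hq
    refine ⟨s', ?_, ?_⟩
    · refine (Runs.loop_step (c := isBit) (by rw [hv']; rfl) (hp.seq hq) (t' := w.length + 1)
        (s'' := s') (by
          convert h1 using 1
          cases r <;> cases r' <;> first | rfl | exact absurd rfl hr)).cast rfl ?_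
      simp only [List.length_cons]
      omega
    · rw [h2]
      cases r <;> cases r' <;> first | exact absurd rfl hr | simp [Store.set, Store.get]

theorem runs_mv (r r' : Reg) (hr : r ≠ r') (w : List Bool) (s : Store) (l : List Letter)
    (hs : s.get r = str w l) :
    Runs (mv r r') s (({ s with v := some Letter.bar }.set r l).set r' (str w.reverse (s.get r')))
      (w.length + 1) := by
  have hp := Runs.push r' (fun _ => Letter.bar) s
  have hq := Runs.pop r (s.set r' (Letter.bar :: s.get r'))
  have he : (s.set r' (Letter.bar :: s.get r')).get r = str w l := by
    rw [← hs]
    cases r <;> cases r' <;> first | rfl | exact absurd rfl hr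
  rw [he] at hq
  obtain ⟨s', h1, h2⟩ := mv_loop r r' hr w
    ({ s.set r' (Letter.bar :: s.get r') with v := (str w l).head? }.set r (str w l).tail) l
    (by cases r <;> rfl) (by cases r <;> rfl)
  refine (hp.seq (hq.seq h1)).cast ?_ ?_
  · rw [h2]
    cases r <;> cases r' <;> first | exact absurd rfl hr | simp [Store.set, Store.get, str]
  · omega

theorem exec_mvAB (w : List Bool) (a b c : List Letter) :
    Exec (mv .A .B) (str w a) b c a (str w.reverse b) c (w.length + 1) := fun v =>
  ⟨_, _, le_rfl, runs_mv .A .B (by simp) w ⟨v, str w a, b, c⟩ a rfl⟩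

theorem exec_mvBA (w : List Bool) (a b c : List Letter) :
    Exec (mv .B .A) a (str w b) c (str w.reverse a) b c (w.length + 1) := fun v =>
  ⟨_, _, le_rfl, runs_mv .B .A (by simp) w ⟨v, a, str w b, c⟩ b rfl⟩

theorem exec_mvBC (w : List Bool) (a b c : List Letter) :
    Exec (mv .B .C) a (str w b) c a b (str w.reverse c) (w.length + 1) := fun v =>
  ⟨_, _, le_rfl, runs_mv .B .C (by simp) w ⟨v, a, str w b, c⟩ b rfl⟩

theorem exec_mvCB (w : List Bool) (a b c : List Letter) :
    Exec (mv .C .B) a b (str w c) a (str w.reverse b) c (w.length + 1) := fun v =>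
  ⟨_, _, le_rfl, runs_mv .C .B (by simp) w ⟨v, a, b, str w c⟩ c rfl⟩

theorem exec_mvCA (w : List Bool) (a b c : List Letter) :
    Exec (mv .C .A) a b (str w c) (str w.reverse a) b c (w.length + 1) := fun v =>
  ⟨_, _, le_rfl, runs_mv .C .A (by simp) w ⟨v, a, b, str w c⟩ c rfl⟩

/-- Copy the string on top of `A` to `C`, in reverse order. -/
def dup : Prog :=
  seq (pushL .B Letter.bar) <| seq (pushL .C Letter.bar) <|
    seq (scan .A (seq (pushV .B) (pushV .C))) (mv .B .A)

theorem exec_dup (w : List Bool) (a b c : List Letter) :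
    Exec dup (str w a) b c (str w a) b (str w.reverse c) (2 * w.length + 2) := by
  have key : ∀ (w : List Bool) (b c : List Letter),
      Runs (loop isBit (seq (seq (pushV .B) (pushV .C)) (pop .A)))
        ⟨(str w a).head?, (str w a).tail, b, c⟩
        ⟨some Letter.bar, a, w.reverse.map Letter.bit ++ b, w.reverse.map Letter.bit ++ c⟩
        (w.length + 1) := by
    intro w
    induction w with
    | nil => intro b c; exact Runs.loop_done rfl
    | cons x w ih =>
      intro b c
      have h := Runs.loop_step (c := isBit) (s := ⟨some (Letter.bit x), str w a, b, c⟩) rfl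
        (((Runs.push _ _ _).seq (Runs.push _ _ _)).seq (Runs.pop _ _))
        (ih (Letter.bit x :: b) (Letter.bit x :: c))
      exact h.cast (by simp) (by simp only [List.length_cons]; omega)
  intro v
  obtain ⟨v', t, ht, h⟩ := exec_mvBA w.reverse a b (str w.reverse c) (some Letter.bar)
  rw [List.reverse_reverse] at h
  refine ⟨v', 0 + (0 + ((0 + (w.length + 1)) + t)), by simp at ht; omega, ?_⟩
  exact (Runs.push _ _ _).seq ((Runs.push _ _ _).seq (((Runs.pop _ _).seq
    (key w (Letter.bar :: b) (Letter.bar :: c))).seq h))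

/-- Remove the string on top of a stack. -/
def drop (r : Reg) : Prog := scan r skip

theorem exec_dropA (w : List Bool) (a b c : List Letter) :
    Exec (drop .A) (str w a) b c a b c (w.length + 1) := by
  have key : ∀ (w : List Bool), Runs (loop isBit (seq skip (pop .A)))
      ⟨(str w a).head?, (str w a).tail, b, c⟩ ⟨some Letter.bar, a, b, c⟩ (w.length + 1) := by
    intro w
    induction w with
    | nil => exact Runs.loop_done rfl
    | cons x w ih =>
      have h := Runs.loop_step (c := isBit) (s := ⟨some (Letter.bit x), str w a, b, c⟩) rfl
        ((Runs.skip _).seq (Runs.pop _ _)) ih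
      exact h.cast rfl (by simp only [List.length_cons]; omega)
  exact fun v => ⟨_, _, by omega, (Runs.pop _ _).seq (key w)⟩

theorem exec_dropB (w : List Bool) (a b c : List Letter) :
    Exec (drop .B) a (str w b) c a b c (w.length + 1) := by
  have key : ∀ (w : List Bool), Runs (loop isBit (seq skip (pop .B)))
      ⟨(str w b).head?, a, (str w b).tail, c⟩ ⟨some Letter.bar, a, b, c⟩ (w.length + 1) := by
    intro w
    induction w with
    | nil => exact Runs.loop_done rfl
    | cons x w ih =>
      have h := Runs.loop_step (c := isBit) (s := ⟨some (Letter.bit x), a, str w b, c⟩) rfl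
        ((Runs.skip _).seq (Runs.pop _ _)) ih
      exact h.cast rfl (by simp only [List.length_cons]; omega)
  exact fun v => ⟨_, _, by omega, (Runs.pop _ _).seq (key w)⟩

/-- Pair the string on top of `B`, reversed, with the one on top of `A`. -/
def join : Prog :=
  seq (pushL .A (Letter.bit false)) (scan .B (seq (pushV .A) (pushL .A (Letter.bit true))))

/-- Popping the reversed copy prepends the bits of `u` from last to first, so `u` comes out in
reading order. -/
theorem exec_join (u w : List Bool) (a b c : List Letter) :
    Exec join (str w a) (str u.reverse b) c (str (penc u w) a) b c (u.length + 1) := by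
  have key : ∀ (u : List Bool) (a : List Letter),
      Runs (loop isBit (seq (seq (pushV .A) (pushL .A (Letter.bit true))) (pop .B)))
        ⟨(str u b).head?, a, (str u b).tail, c⟩
        ⟨some Letter.bar, (u.reverse.flatMap fun x => [Letter.bit true, Letter.bit x]) ++ a, b, c⟩
        (u.length + 1) := by
    intro u
    induction u with
    | nil => intro a; exact Runs.loop_done rfl
    | cons x u ih =>
      intro a
      have h := Runs.loop_step (c := isBit) (s := ⟨some (Letter.bit x), a, str u b, c⟩) rfl
        (((Runs.push _ _ _).seq (Runs.push _ _ _)).seq (Runs.pop _ _))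
        (ih (Letter.bit true :: Letter.bit x :: a))
      exact h.cast (by simp) (by simp only [List.length_cons]; omega)
  intro v
  have h := (Runs.push .A (fun _ => Letter.bit false) ⟨v, str w a, str u.reverse b, c⟩).seq
    ((Runs.pop .B _).seq (key u.reverse (Letter.bit false :: str w a)))
  refine ⟨some Letter.bar, u.length + 1, le_rfl, h.cast ?_ (by simp)⟩
  simp [str, penc, List.map_flatMap]

/-- Like `join`, but the string on `B` is not removed. -/
def joinKeep : Prog :=
  seq (pushL .C Letter.bar) <| seq (pushL .A (Letter.bit false)) <|
    seq (scan .B (seq (pushV .C) (seq (pushV .A) (pushL .A (Letter.bit true))))) (mv .C .B)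

theorem exec_joinKeep (u w : List Bool) (a b c : List Letter) :
    Exec joinKeep (str w a) (str u.reverse b) c (str (penc u w) a) (str u.reverse b) c
      (2 * u.length + 2) := by
  have key : ∀ (u : List Bool) (a c : List Letter),
      Runs (loop isBit (seq (seq (pushV .C) (seq (pushV .A) (pushL .A (Letter.bit true)))) (pop .B)))
        ⟨(str u b).head?, a, (str u b).tail, c⟩
        ⟨some Letter.bar, (u.reverse.flatMap fun x => [Letter.bit true, Letter.bit x]) ++ a, b,
          u.reverse.map Letter.bit ++ c⟩
        (u.length + 1) := by
    intro u
    induction u with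
    | nil => intro a c; exact Runs.loop_done rfl
    | cons x u ih =>
      intro a c
      have h := Runs.loop_step (c := isBit) (s := ⟨some (Letter.bit x), a, str u b, c⟩) rfl
        (((Runs.push _ _ _).seq ((Runs.push _ _ _).seq (Runs.push _ _ _))).seq (Runs.pop _ _))
        (ih (Letter.bit true :: Letter.bit x :: a) (Letter.bit x :: c))
      exact h.cast (by simp) (by simp only [List.length_cons]; omega)
  intro v
  obtain ⟨v', t, ht, h⟩ := exec_mvCB u (str (penc u w) a) b c (some Letter.bar)
  have h1 := key u.reverse (Letter.bit false :: str w a) (Letter.bar :: c)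
  refine ⟨v', 0 + (0 + ((0 + (u.length + 1)) + t)), by omega, ?_⟩
  refine (Runs.push _ _ _).seq ((Runs.push _ _ _).seq (((Runs.pop _ _).seq ?_).seq h))
  exact h1.cast (by simp [str, penc, List.map_flatMap]) (by simp)

/-- Split a pair on top of a stack; its first component is moved to `B` and reversed. -/
def split (r : Reg) : Prog :=
  seq (pushL .B Letter.bar) <| seq (pop r) <|
    loop isOne (seq (pop r) (seq (pushV .B) (pop r)))

theorem exec_splitA (u w : List Bool) (a b c : List Letter) :
    Exec (split .A) (str (penc u w) a) b c (str w a) (str u.reverse b) c (u.length + 1) := by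
  have key : ∀ (u : List Bool) (b : List Letter),
      Runs (loop isOne (seq (pop .A) (seq (pushV .B) (pop .A))))
        ⟨(str (penc u w) a).head?, (str (penc u w) a).tail, b, c⟩
        ⟨some (Letter.bit false), str w a, u.reverse.map Letter.bit ++ b, c⟩ (u.length + 1) := by
    intro u
    induction u with
    | nil => intro b; exact Runs.loop_done rfl
    | cons x u ih =>
      intro b
      have h := Runs.loop_step (c := isOne)
        (s := ⟨some (Letter.bit true), Letter.bit x :: str (penc u w) a, b, c⟩) rfl
        ((Runs.pop _ _).seq ((Runs.push _ _ _).seq (Runs.pop _ _))) (ih (Letter.bit x :: b))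
      exact h.cast (by simp) (by simp only [List.length_cons]; omega)
  intro v
  refine ⟨some (Letter.bit false), 0 + (0 + (u.length + 1)), by omega, ?_⟩
  refine (Runs.push _ _ _).seq ((Runs.pop _ _).seq ?_)
  exact (key u (Letter.bar :: b)).cast (by simp [str]) rfl

theorem exec_splitC (u w : List Bool) (a b c : List Letter) :
    Exec (split .C) a b (str (penc u w) c) a (str u.reverse b) (str w c) (u.length + 1) := by
  have key : ∀ (u : List Bool) (b : List Letter),
      Runs (loop isOne (seq (pop .C) (seq (pushV .B) (pop .C))))
        ⟨(str (penc u w) c).head?, a, b, (str (penc u w) c).tail⟩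
        ⟨some (Letter.bit false), a, u.reverse.map Letter.bit ++ b, str w c⟩ (u.length + 1) := by
    intro u
    induction u with
    | nil => intro b; exact Runs.loop_done rfl
    | cons x u ih =>
      intro b
      have h := Runs.loop_step (c := isOne)
        (s := ⟨some (Letter.bit true), a, b, Letter.bit x :: str (penc u w) c⟩) rfl
        ((Runs.pop _ _).seq ((Runs.push _ _ _).seq (Runs.pop _ _))) (ih (Letter.bit x :: b))
      exact h.cast (by simp) (by simp only [List.length_cons]; omega)
  intro v
  refine ⟨some (Letter.bit false), 0 + (0 + (u.length + 1)), by omega, ?_⟩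
  refine (Runs.push _ _ _).seq ((Runs.pop _ _).seq ?_)
  exact (key u (Letter.bar :: b)).cast (by simp [str]) rfl

/-- Push a fixed string on `A`. -/
def pushStr (w : List Bool) : Prog :=
  w.foldr (fun x p => seq p (pushL .A (Letter.bit x))) (pushL .A Letter.bar)

theorem exec_pushStr (w : List Bool) (a b c : List Letter) :
    Exec (pushStr w) a b c (str w a) b c 0 := by
  induction w with
  | nil => exact fun v => ⟨v, 0, le_rfl, Runs.push _ _ _⟩
  | cons x w ih =>
    intro v
    obtain ⟨v', t, ht, h⟩ := ih v
    exact ⟨v', t + 0, by omega, h.seq (Runs.push _ _ _)⟩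

end Prog

open Prog

/-! ### Functions computable in polynomial time -/

/-- Values that are written as strings. -/
class Enc (α : Type) where
  raw : α → List Bool

open Enc (raw)

/-- The length of the string for `x`. -/
def sz {α : Type} [Enc α] (x : α) : ℕ := (raw x).length

instance : Enc Bool := ⟨fun b => [b]⟩

instance {α β : Type} [Enc α] [Enc β] : Enc (α × β) := ⟨fun x => penc (raw x.1) (raw x.2)⟩

/-- No end mark is needed: nonempty lists have nonempty codes, so the bar that closes the string
also signals the end of the list. -/
def rawList {α : Type} [Enc α] : List α → List Bool
  | [] => []
  | x :: l => penc (raw x) (rawList l)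

instance {α : Type} [Enc α] : Enc (List α) := ⟨rawList⟩

section

variable {α β γ δ : Type} [Enc α] [Enc β] [Enc γ] [Enc δ]

theorem raw_cons (x : α) (l : List α) : raw (x :: l) = penc (raw x) (raw l) := rfl

@[simp] theorem sz_bool (b : Bool) : sz b = 1 := rfl

@[simp] theorem sz_pair (x : α) (y : β) : sz (x, y) = 2 * sz x + 1 + sz y := length_penc _ _

@[simp] theorem sz_nil : sz ([] : List α) = 0 := rfl

@[simp] theorem sz_cons (x : α) (l : List α) : sz (x :: l) = 2 * sz x + 1 + sz l := length_penc _ _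

@[simp] theorem sz_append (l l' : List α) : sz (l ++ l') = sz l + sz l' := by
  induction l with
  | nil => simp
  | cons x l ih => simp [ih]; omega

@[simp] theorem sz_reverse (l : List α) : sz l.reverse = sz l := by
  induction l with
  | nil => simp
  | cons x l ih => simp [ih]; omega

theorem length_le_sz (l : List α) : l.length ≤ sz l := by
  induction l with
  | nil => simp
  | cons x l ih => simp; omega

theorem sz_le_of_mem {x : α} {l : List α} (h : x ∈ l) : sz x ≤ sz l := by
  induction l with
  | nil => simp at h
  | cons y l ih =>
    rcases List.mem_cons.1 h with rfl | h
    · simp; omega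
    · have := ih h
      simp; omega

/-! ### Polynomially bounded functions -/

theorem eval_mono (q : Polynomial ℕ) {m n : ℕ} (h : m ≤ n) : q.eval m ≤ q.eval n := by
  rw [Polynomial.eval_eq_sum_range, Polynomial.eval_eq_sum_range]
  gcongr

/-- `φ` is bounded by a polynomial in the size of its argument. -/
def PB (φ : α → ℕ) : Prop := ∃ q : Polynomial ℕ, ∀ x, φ x ≤ q.eval (sz x)

theorem PB.mono {φ ψ : α → ℕ} (h : PB ψ) (hφ : ∀ x, φ x ≤ ψ x) : PB φ := by
  obtain ⟨q, hq⟩ := h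
  exact ⟨q, fun x => (hφ x).trans (hq x)⟩

theorem PB.eval {φ : α → ℕ} (h : PB φ) (q : Polynomial ℕ) : PB fun x => q.eval (φ x) := by
  obtain ⟨q', hq⟩ := h
  exact ⟨q.comp q', fun x => by rw [Polynomial.eval_comp]; exact eval_mono q (hq x)⟩

theorem PB.sz : PB fun x : α => sz x := ⟨Polynomial.X, by simp⟩

theorem PB.const (n : ℕ) : PB fun _ : α => n := ⟨Polynomial.C n, by simp⟩

theorem PB.add {φ ψ : α → ℕ} (h : PB φ) (h' : PB ψ) : PB fun x => φ x + ψ x := by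
  obtain ⟨q, hq⟩ := h
  obtain ⟨q', hq'⟩ := h'
  exact ⟨q + q', fun x => by rw [Polynomial.eval_add]; exact add_le_add (hq x) (hq' x)⟩

theorem PB.mul {φ ψ : α → ℕ} (h : PB φ) (h' : PB ψ) : PB fun x => φ x * ψ x := by
  obtain ⟨q, hq⟩ := h
  obtain ⟨q', hq'⟩ := h'
  exact ⟨q * q', fun x => by rw [Polynomial.eval_mul]; exact Nat.mul_le_mul (hq x) (hq' x)⟩

theorem PB.comp {φ : β → ℕ} {f : α → β} (h : PB φ) (hf : PB fun x => Manipulation.sz (f x)) :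
    PB fun x => φ (f x) := by
  obtain ⟨q, hq⟩ := h
  exact (hf.eval q).mono fun x => hq (f x)

/-! ### Closure properties of the polynomial-time functions -/

/-- `f` is computed by a program in polynomial time. -/
@[fun_prop] def PT (f : α → β) : Prop :=
  -- What lies below on the stacks is arbitrary and preserved, so programs can serve as subroutines.
  -- The bound on the size of the result is what keeps compositions polynomial.
  (∃ p : Prog, ∃ n : α → ℕ, PB n ∧ ∀ x a b c,
    Exec p (str (raw x) a) b c (str (raw (f x)) a) b c (n x)) ∧ PB fun x => sz (f x)

theorem PT.bound {f : α → β} (h : PT f) : PB fun x => sz (f x) := h.2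

@[fun_prop] theorem PT.id : PT fun x : α => x :=
  ⟨⟨skip, _, PB.const 0, fun _ _ _ _ v => ⟨v, 0, le_rfl, Runs.skip _⟩⟩, PB.sz⟩

/-- Functions with the same strings are computed by the same program. -/
theorem PT.of_raw_eq {f : α → β} {g : α → γ} (h : PT f) (he : ∀ x, raw (g x) = raw (f x)) :
    PT g := by
  obtain ⟨⟨p, n, hn, hp⟩, hb⟩ := h
  exact ⟨⟨p, n, hn, fun x a b c => by rw [he]; exact hp x a b c⟩,
    hb.mono fun x => by unfold Manipulation.sz; rw [he]⟩

@[fun_prop] theorem PT.comp {g : β → γ} {f : α → β} (hg : PT g) (hf : PT f) : PT fun x => g (f x) := by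
  obtain ⟨⟨p, n, hn, hp⟩, hb⟩ := hg
  obtain ⟨⟨p', n', hn', hp'⟩, hb'⟩ := hf
  exact ⟨⟨p'.seq p, _, hn'.add (hn.comp hb'), fun x a b c => (hp' x a b c).seq (hp (f x) a b c)⟩,
    hb.comp hb'⟩

@[fun_prop] theorem PT.const (y : β) : PT fun _ : α => y :=
  ⟨⟨(drop .A).seq (pushStr (raw y)), _, (PB.sz.add (PB.const 1)).add (PB.const 0),
    fun _ a b c => (exec_dropA _ a b c).seq (exec_pushStr _ a b c)⟩, PB.const (Manipulation.sz y)⟩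

-- A copy of the input waits on `C` while `f x` is computed; then `f x` is parked on `B`, the input
-- is restored, and `g x` is computed and joined with `f x`.
@[fun_prop] theorem PT.pair {f : α → β} {g : α → γ} (hf : PT f) (hg : PT g) : PT fun x => (f x, g x) := by
  obtain ⟨⟨p, n, hn, hp⟩, hb⟩ := hf
  obtain ⟨⟨p', n', hn', hp'⟩, hb'⟩ := hg
  refine ⟨⟨dup.seq (p.seq ((mv .A .B).seq ((mv .C .A).seq (p'.seq join)))), fun x =>
    (2 * sz x + 2) + (n x + ((sz (f x) + 1) + ((sz x + 1) + (n' x + (sz (f x) + 1))))), ?_, ?_⟩, ?_⟩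
  · exact (((PB.const 2).mul PB.sz).add (PB.const 2)).add (hn.add ((hb.add (PB.const 1)).add
      ((PB.sz.add (PB.const 1)).add (hn'.add (hb.add (PB.const 1))))))
  · intro x a b c
    have h := exec_mvCA (raw x).reverse a (str (raw (f x)).reverse b) c
    rw [List.reverse_reverse, List.length_reverse] at h
    exact (exec_dup _ a b c).seq ((hp x _ _ _).seq ((exec_mvAB _ _ _ _).seq
      (h.seq ((hp' x _ _ _).seq (exec_join _ _ _ _ _)))))
  · refine (((PB.const 2).mul hb).add (PB.const 1)).add hb' |>.mono fun x => ?_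
    simp

@[fun_prop] theorem PT.fst : PT (Prod.fst : α × β → α) := by
  have hb : PB fun x : α × β => Manipulation.sz x.1 := PB.sz.mono fun x => by
    rw [← Prod.mk.eta (p := x), sz_pair]; dsimp; omega
  have hb' : PB fun x : α × β => Manipulation.sz x.2 := PB.sz.mono fun x => by
    rw [← Prod.mk.eta (p := x), sz_pair]; dsimp; omega
  refine ⟨⟨(split .A).seq ((drop .A).seq (mv .B .A)), _,
    (hb.add (PB.const 1)).add ((hb'.add (PB.const 1)).add (hb.add (PB.const 1))), ?_⟩, hb⟩
  intro x a b c
  have h := exec_mvBA (raw x.1).reverse a b c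
  rw [List.reverse_reverse, List.length_reverse] at h
  exact (exec_splitA _ _ _ _ _).seq ((exec_dropA _ _ _ _).seq h)

@[fun_prop] theorem PT.snd : PT (Prod.snd : α × β → β) := by
  have hb : PB fun x : α × β => Manipulation.sz x.1 := PB.sz.mono fun x => by
    rw [← Prod.mk.eta (p := x), sz_pair]; dsimp; omega
  have hb' : PB fun x : α × β => Manipulation.sz x.2 := PB.sz.mono fun x => by
    rw [← Prod.mk.eta (p := x), sz_pair]; dsimp; omega
  refine ⟨⟨(split .A).seq (drop .B), _, (hb.add (PB.const 1)).add (hb.add (PB.const 1)), ?_⟩, hb'⟩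
  intro x a b c
  have h := exec_dropB (raw x.1).reverse (str (raw x.2) a) b c
  rw [List.length_reverse] at h
  exact (exec_splitA _ _ _ _ _).seq h

@[fun_prop] theorem PT.cond {t : α → Bool} {f g : α → β} (ht : PT t) (hf : PT f) (hg : PT g) :
    PT fun x => bif t x then f x else g x := by
  obtain ⟨⟨p, n, hn, hp⟩, -⟩ := ht
  obtain ⟨⟨p', n', hn', hp'⟩, hb'⟩ := hf
  obtain ⟨⟨p'', n'', hn'', hp''⟩, hb''⟩ := hg
  -- The first `pop` reads the truth value; the ones inside the branches remove its bar.
  refine ⟨⟨dup.seq (p.seq ((pop .A).seq (ite isOne ((pop .A).seq ((mv .C .A).seq p'))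
    ((pop .A).seq ((mv .C .A).seq p''))))), fun x =>
    (2 * sz x + 2) + (n x + ((sz x + 1) + (n' x + n'' x))), ?_, ?_⟩, ?_⟩
  · exact (((PB.const 2).mul PB.sz).add (PB.const 2)).add (hn.add
      ((PB.sz.add (PB.const 1)).add (hn'.add hn'')))
  · intro x a b c
    have h := exec_mvCA (raw x).reverse a b c
    rw [List.reverse_reverse, List.length_reverse] at h
    refine (exec_dup _ a b c).seq ((hp x _ _ _).seq fun v => ?_)
    cases htx : t x with
    | true =>
      simp only [htx, cond_true]
      obtain ⟨v', s, hs, r⟩ := (h.seq (hp' x a b c)) (some Letter.bar)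
      refine ⟨v', 0 + (0 + s), ?_, (Runs.pop _ _).seq (Runs.ite_true rfl ((Runs.pop _ _).seq r))⟩
      show _ ≤ sz x + 1 + (n' x + n'' x)
      change s ≤ sz x + 1 + n' x at hs
      omega
    | false =>
      simp only [htx, cond_false]
      obtain ⟨v', s, hs, r⟩ := (h.seq (hp'' x a b c)) (some Letter.bar)
      refine ⟨v', 0 + (0 + s), ?_, (Runs.pop _ _).seq (Runs.ite_false rfl ((Runs.pop _ _).seq r))⟩
      show _ ≤ sz x + 1 + (n' x + n'' x)
      change s ≤ sz x + 1 + n'' x at hs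
      omega
  · refine (hb'.add hb'').mono fun x => ?_
    cases h : t x <;> simp [h]

/-! ### Iteration over a list -/

/-- The loop of a program that folds `p` over the list on `C`, with a parameter on `B`. -/
def foldLoop (p : Prog) : Prog :=
  loop isBit <| seq (pushV .C) <| seq (seq (split .C) (seq join (seq joinKeep p))) (pop .C)

/-- Invariant: `A` holds the accumulator, `B` the reversed parameter, `C` and the variable the rest
of the list. The time bound on `p` is required only for accumulators that really occur. One round
costs a test, splitting and joining an element (at most `m + 1` each), attaching the parameter (`2 *
w.length + 2`) and `p`. -/
theorem exec_foldLoop {p : Prog} {w : List Bool} {h : β → α → β} {n m : ℕ} (l : List α) (s : β)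
    (hp : ∀ pre x, pre ++ [x] <+: l → ∀ a b c,
      Exec p (str (penc w (penc (raw x) (raw (pre.foldl h s)))) a) b c
        (str (raw (h (pre.foldl h s) x)) a) b c n)
    (hm : ∀ x ∈ l, sz x ≤ m) (a b c : List Letter) :
    ∃ t ≤ l.length * (2 * m + 2 * w.length + n + 5) + 1,
      Runs (foldLoop p)
        ⟨(str (raw l) c).head?, str (raw s) a, str w.reverse b, (str (raw l) c).tail⟩
        ⟨some Letter.bar, str (raw (l.foldl h s)) a, str w.reverse b, c⟩ t := by
  induction l generalizing s with
  | nil => exact ⟨1, by simp, Runs.loop_done rfl⟩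
  | cons x l ih =>
    obtain ⟨t, ht, r⟩ := ih (h s x)
      (fun pre y hy => hp (x :: pre) y (by simpa using hy)) (fun y hy => hm y (by simp [hy]))
    -- The test has consumed the first letter `d` of the code; the loop body starts by pushing it
    -- back.
    obtain ⟨d, ds, hd⟩ : ∃ d ds, penc (raw x) (raw l) = d :: ds := by
      unfold penc
      cases raw x <;> simp
    have h1 := ((exec_splitC (raw x) (raw l) (str (raw s) a) (str w.reverse b) c).seq
      ((exec_join (raw x) (raw s) a (str w.reverse b) (str (raw l) c)).seq
      ((exec_joinKeep w _ a b (str (raw l) c)).seq (hp [] x (by simp) a _ _))))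
    obtain ⟨v', t', ht', r'⟩ := h1 (some (Letter.bit d))
    refine ⟨1 + (0 + (t' + 0)) + t, ?_, ?_⟩
    · have hx : (raw x).length ≤ m := hm x (by simp)
      simp only [List.length_cons, Nat.add_mul, Nat.one_mul] at ht ⊢
      omega
    · rw [raw_cons, hd] at *
      exact Runs.loop_step rfl ((Runs.push _ _ _).seq (Runs.seq r' (Runs.pop _ _))) r

/-- The program that folds `p` over a list. -/
def fold (p : Prog) : Prog :=
  seq (split .A) <| seq (split .A) <| seq (mv .B .C) <| seq (seq (pop .C) (foldLoop p)) (drop .B)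

/-- The bound `B` on all intermediate accumulators is essential: iterating a polynomial-time step,
for instance a doubling, may otherwise produce exponential size. -/
theorem PT.foldl {f : γ → List α} {g : γ → β} {h : γ → β → α → β} (hf : PT f) (hg : PT g)
    (hh : PT fun x : γ × α × β => h x.1 x.2.2 x.2.1) {B : γ → ℕ} (hB : PB B)
    (bd : ∀ c pre, pre <+: f c → sz (pre.foldl (h c) (g c)) ≤ B c) :
    PT fun c => (f c).foldl (h c) (g c) := by
  obtain ⟨⟨p, n, ⟨q, hq⟩, hp⟩, -⟩ := hh
  obtain ⟨⟨p0, n0, hn0, hp0⟩, hb0⟩ := PT.id.pair (hf.pair hg)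
  have hb : PB fun c => Manipulation.sz ((f c).foldl (h c) (g c)) :=
    hB.mono fun c => bd c _ (List.prefix_refl _)
  -- `N` bounds the time of every round: its argument bounds the size of the triple of parameter,
  -- list element and accumulator.
  let N : γ → ℕ := fun c => q.eval (2 * sz c + 1 + (2 * sz (f c) + 1 + B c))
  have hN : PB N := ((((PB.const 2).mul PB.sz).add (PB.const 1)).add
    ((((PB.const 2).mul hf.bound).add (PB.const 1)).add hB)).eval q
  refine ⟨⟨p0.seq (fold p), fun c => n0 c + ((sz c + 1) + ((sz (f c) + 1) + ((sz (f c) + 1) +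
    ((sz (f c) * (2 * sz (f c) + 2 * sz c + N c + 5) + 1) + (sz c + 1))))), ?_, ?_⟩, hb⟩
  · refine hn0.add ((PB.sz.add (PB.const 1)).add ((hf.bound.add (PB.const 1)).add
      ((hf.bound.add (PB.const 1)).add (((hf.bound.mul ?_).add (PB.const 1)).add
      (PB.sz.add (PB.const 1))))))
    exact ((((PB.const 2).mul hf.bound).add ((PB.const 2).mul PB.sz)).add hN).add (PB.const 5)
  · intro x a b c
    have h1 := exec_mvBC (raw (f x)).reverse (str (raw (g x)) a) (str (raw x).reverse b) c
    rw [List.reverse_reverse, List.length_reverse] at h1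
    have h2 := exec_dropB (raw x).reverse (str (raw ((f x).foldl (h x) (g x))) a) b c
    rw [List.length_reverse] at h2
    refine (hp0 x a b c).seq ((exec_splitA _ _ _ _ _).seq ((exec_splitA _ _ _ _ _).seq
      (h1.seq (Exec.seq (fun v => ?_) h2))))
    have key : ∀ pre y, pre ++ [y] <+: f x → n (x, y, pre.foldl (h x) (g x)) ≤ N x := by
      intro pre y hy
      have h3 : y ∈ f x := hy.subset (by simp)
      have h4 := sz_le_of_mem h3
      have h5 := bd x pre ((List.prefix_append _ _).trans hy)
      refine (hq _).trans (eval_mono q ?_)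
      simp only [sz_pair]
      omega
    obtain ⟨t, ht, r⟩ := exec_foldLoop (p := p) (w := raw x) (h := h x) (n := N x)
      (m := sz (f x)) (f x) (g x) (fun pre y hy a b c => (hp (x, y, _) a b c).mono (key pre y hy))
      (fun y hy => sz_le_of_mem hy) a b c
    refine ⟨some Letter.bar, 0 + t, ?_, (Runs.pop _ _).seq r⟩
    rw [Nat.zero_add]
    exact ht.trans (Nat.add_le_add_right (Nat.mul_le_mul_right _ (length_le_sz _)) 1)

end

/-! ### From programs to decision problems in P -/

/-- Letters as triples of bits. -/
def Letter.triple : Letter → Bool × Bool × Bool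
  | .bit b => (true, b, false)
  | .minus => (false, true, true)
  | .comma => (false, true, false)
  | .bar => (false, false, false)

instance : Enc Letter := ⟨fun l => raw l.triple⟩

theorem PT.triple : PT Letter.triple := PT.id.of_raw_eq fun _ => rfl

theorem sz_letter (l : Letter) : sz l = 7 := by cases l <;> rfl

theorem sz_letters (l : List Letter) : sz l = 15 * l.length := by
  induction l with
  | nil => rfl
  | cons x l ih => simp [ih, sz_letter]; omega

/-- The part of the code of a list that belongs to a letter. -/
def chunk (l : Letter) : List Bool := penc (raw l) []

theorem raw_letters (l : List Letter) : raw l = l.flatMap chunk := by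
  induction l with
  | nil => rfl
  | cons x l ih => simp [raw_cons, penc, chunk, ih]

namespace Prog

/-- Push the values of several functions of the variable. -/
def pushes (fs : List (Option Letter → Letter)) : Prog :=
  fs.foldr (fun f p => seq (push .B f) p) skip

theorem runs_pushes (fs : List (Option Letter → Letter)) (v : Option Letter)
    (a b c : List Letter) :
    Runs (pushes fs) ⟨v, a, b, c⟩ ⟨v, a, (fs.map (· v)).reverse ++ b, c⟩ 0 := by
  induction fs generalizing b with
  | nil => exact Runs.skip _
  | cons f fs ih =>
    exact ((Runs.push .B f ⟨v, a, b, c⟩).seq (ih (f v :: b))).cast (by simp) rfl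

/-- A triple of bits has a code of length 7, so as an entry of a list a letter occupies `2 * 7 + 1 =
15` bits. -/
def pushChunk : Prog :=
  pushes ((List.range 15).map fun i v => Letter.bit ((chunk (v.getD Letter.bar)).getD i false))

theorem runs_pushChunk (l : Letter) (a b c : List Letter) :
    Runs pushChunk ⟨some l, a, b, c⟩
      ⟨some l, a, (chunk l).reverse.map Letter.bit ++ b, c⟩ 0 := by
  refine (runs_pushes _ _ _ _ _).cast ?_ rfl
  congr 2

/-- Turn the content of `A` into one string. -/
def readAll : Prog :=
  seq (pushL .B Letter.bar) <|
    seq (seq (pop .A) (loop (fun v => v.isSome) (seq pushChunk (pop .A)))) (mv .B .A)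

theorem exec_readAll (l : List Letter) :
    Exec readAll l [] [] (str (raw l) []) [] [] (16 * l.length + 2) := by
  have key : ∀ (l b : List Letter),
      Runs (loop (fun v => v.isSome) (seq pushChunk (pop .A))) ⟨l.head?, l.tail, b, []⟩
        ⟨none, [], (raw l).reverse.map Letter.bit ++ b, []⟩ (l.length + 1) := by
    intro l
    induction l with
    | nil => intro b; exact Runs.loop_done rfl
    | cons x l ih =>
      intro b
      have h := Runs.loop_step (c := fun v => v.isSome) (s := ⟨some x, l, b, []⟩) rfl
        ((runs_pushChunk x l b []).seq (Runs.pop _ _)) (ih _)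
      exact h.cast (by simp [raw_letters]) (by simp only [List.length_cons]; omega)
  intro v
  obtain ⟨v', t, ht, h⟩ := exec_mvBA (raw l).reverse [] [] [] none
  rw [List.reverse_reverse] at h
  have h1 : (raw l).length = 15 * l.length := sz_letters l
  rw [List.length_reverse, h1] at ht
  exact ⟨v', 0 + ((0 + (l.length + 1)) + t), by omega,
    (Runs.push _ _ _).seq (((Runs.pop _ _).seq (key l [Letter.bar])).seq h)⟩

end Prog

theorem inP_of_PT {X : Type} (e : Computability.Encoding X Letter) (L : X → Prop)
    {d : List Letter → Bool} (hd : PT d) (h : ∀ x, d (e.encode x) = true ↔ L x) : InP e L := by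
  classical
  obtain ⟨⟨p, n, ⟨q, hq⟩, hp⟩, -⟩ := hd
  -- For an input of length `ℓ`, reading takes at most `16ℓ + 2` steps and the start one more, and
  -- `p` works on a string of length `15ℓ`.
  have hm : ∀ x, Nonempty (Turing.TM2OutputsInTime (machine (readAll.seq p)) (e.encode x)
      (some [decide (L x)])
      ((Polynomial.C 16 * Polynomial.X + Polynomial.C 3 +
        q.comp (Polynomial.C 15 * Polynomial.X)).eval (e.encode x).length)) := by
    intro x
    obtain ⟨v, t, ht, r⟩ := ((exec_readAll (e.encode x)).seq (hp _ [] [] [])) none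
    have hb : d (e.encode x) = decide (L x) := by
      rw [Bool.eq_iff_iff, h, decide_eq_true_iff]
    rw [hb] at r
    obtain ⟨o⟩ := Runs.outputs (b := decide (L x)) r
    refine ⟨⟨o.toEvalsTo, o.steps_le_m.trans ?_⟩⟩
    have h1 := hq (e.encode x)
    rw [sz_letters] at h1
    simp only [Polynomial.eval_add, Polynomial.eval_mul, Polynomial.eval_C, Polynomial.eval_X,
      Polynomial.eval_comp]
    omega
  refine ⟨⟨⟨machine (readAll.seq p), Equiv.refl Letter, Equiv.refl Bool⟩,
    Polynomial.C 16 * Polynomial.X + Polynomial.C 3 + q.comp (Polynomial.C 15 * Polynomial.X),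
    fun x => ?_⟩⟩
  have h1 : List.map (Equiv.refl Letter).invFun (e.encode x) = e.encode x := List.map_id _
  have h2 : ∀ l, l = e.encode x → Nonempty (Turing.TM2OutputsInTime (machine (readAll.seq p)) l
      (some [decide (L x)])
      ((Polynomial.C 16 * Polynomial.X + Polynomial.C 3 +
        q.comp (Polynomial.C 15 * Polynomial.X)).eval (e.encode x).length)) := by
    rintro _ rfl
    exact hm x
  exact (h2 _ h1).some

/-! ### Booleans and lists -/

section

variable {α β γ δ : Type} [Enc α] [Enc β] [Enc γ] [Enc δ]

@[fun_prop] theorem PT.not {f : α → Bool} (hf : PT f) : PT fun x => !f x := by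
  have : PT fun x => bif f x then false else true := by fun_prop
  exact this.of_raw_eq fun x => by cases f x <;> rfl

@[fun_prop] theorem PT.and {f g : α → Bool} (hf : PT f) (hg : PT g) : PT fun x => f x && g x := by
  have : PT fun x => bif f x then g x else false := by fun_prop
  exact this.of_raw_eq fun x => by cases f x <;> rfl

@[fun_prop] theorem PT.or {f g : α → Bool} (hf : PT f) (hg : PT g) : PT fun x => f x || g x := by
  have : PT fun x => bif f x then true else g x := by fun_prop
  exact this.of_raw_eq fun x => by cases f x <;> rfl

@[fun_prop] theorem PT.cons {f : γ → α} {g : γ → List α} (hf : PT f) (hg : PT g) :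
    PT fun x => f x :: g x :=
  (hf.pair hg).of_raw_eq fun _ => rfl

/-- Iteration, when each step adds a bounded amount to some measure of the size. -/
theorem PT.foldl_of_growth {f : γ → List α} {g : γ → β} {h : γ → β → α → β} (hf : PT f)
    (hg : PT g) (hh : PT fun x : γ × α × β => h x.1 x.2.2 x.2.1) (ν : β → ℕ) (C : ℕ)
    (h1 : ∀ s, ν s ≤ C * sz s + C) (h2 : ∀ s, sz s ≤ C * ν s + C) {K : γ → ℕ} (hK : PB K)
    (h3 : ∀ c s, ∀ x ∈ f c, ν (h c s x) ≤ ν s + K c) :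
    PT fun c => (f c).foldl (h c) (g c) := by
  -- The measure grows additively, whereas the size itself might double when data change their place
  -- in a pair; linear comparability converts the start value to `ν` and the final one back.
  refine PT.foldl (B := fun c => C * ((C * sz (g c) + C) + sz (f c) * K c) + C) hf hg hh ?_ ?_
  · exact ((PB.const C).mul ((((PB.const C).mul hg.bound).add (PB.const C)).add
      (hf.bound.mul hK))).add (PB.const C)
  · intro c pre hpre
    have key : ∀ (l : List α) (s : β), (∀ x ∈ l, x ∈ f c) →
        ν (l.foldl (h c) s) ≤ ν s + l.length * K c := by
      intro l
      induction l with
      | nil => intro s _; simp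
      | cons x l ih =>
        intro s hl
        have h4 := ih (h c s x) fun y hy => hl y (by simp [hy])
        have h5 := h3 c s x (hl x (by simp))
        simp only [List.foldl_cons, List.length_cons, Nat.add_mul, Nat.one_mul]
        omega
    have h4 := key pre (g c) fun x hx => hpre.subset hx
    have h5 : pre.length * K c ≤ sz (f c) * K c :=
      Nat.mul_le_mul_right _ (hpre.length_le.trans (length_le_sz _))
    refine (h2 _).trans (Nat.add_le_add_right (Nat.mul_le_mul_left _ ?_) _)
    have := h1 (g c)
    omega

@[fun_prop] theorem PT.reverse {f : γ → List α} (hf : PT f) : PT fun x => (f x).reverse := by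
  have : PT fun c => (f c).foldl (fun s x => x :: s) [] := by
    refine PT.foldl_of_growth (K := fun c => 2 * sz (f c) + 1) hf (PT.const _) (by fun_prop)
      sz 1 (by simp) (by simp) (((PB.const 2).mul hf.bound).add (PB.const 1)) ?_
    intro c s x hx
    have := sz_le_of_mem hx
    simp only [sz_cons]
    omega
  exact this.of_raw_eq fun x => by simp

theorem PT.foldr {f : γ → List α} {g : γ → β} {h : γ → α → β → β} (hf : PT f) (hg : PT g)
    (hh : PT fun x : γ × α × β => h x.1 x.2.1 x.2.2) {B : γ → ℕ} (hB : PB B)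
    (bd : ∀ c suf, suf <:+ f c → sz (suf.foldr (h c) (g c)) ≤ B c) :
    PT fun c => (f c).foldr (h c) (g c) := by
  have : PT fun c => (f c).reverse.foldl (fun s x => h c x s) (g c) := by
    refine PT.foldl hf.reverse hg hh hB fun c pre hpre => ?_
    have h1 := bd c pre.reverse (by rw [← List.reverse_prefix, List.reverse_reverse]; exact hpre)
    rwa [List.foldr_reverse] at h1
  exact this.of_raw_eq fun x => by rw [List.foldl_reverse]

theorem PT.foldr_of_growth {f : γ → List α} {g : γ → β} {h : γ → α → β → β} (hf : PT f)
    (hg : PT g) (hh : PT fun x : γ × α × β => h x.1 x.2.1 x.2.2) (ν : β → ℕ) (C : ℕ)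
    (h1 : ∀ s, ν s ≤ C * sz s + C) (h2 : ∀ s, sz s ≤ C * ν s + C) {K : γ → ℕ} (hK : PB K)
    (h3 : ∀ c s, ∀ x ∈ f c, ν (h c x s) ≤ ν s + K c) :
    PT fun c => (f c).foldr (h c) (g c) := by
  have : PT fun c => (f c).reverse.foldl (fun s x => h c x s) (g c) :=
    PT.foldl_of_growth hf.reverse hg hh ν C h1 h2 hK
      fun c s x hx => h3 c s x (List.mem_reverse.1 hx)
  exact this.of_raw_eq fun x => by rw [List.foldl_reverse]

@[fun_prop] theorem PT.headD {f : γ → List α} {g : γ → α} (hf : PT f) (hg : PT g) :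
    PT fun x => (f x).headD (g x) := by
  have : PT fun c => (f c).foldr (fun x _ => x) (g c) := by
    refine PT.foldr (B := fun c => sz (f c) + sz (g c)) hf hg (by fun_prop)
      (hf.bound.add hg.bound) ?_
    intro c suf hsuf
    cases suf with
    | nil => simp
    | cons x l =>
      have := sz_le_of_mem (hsuf.subset (List.mem_cons_self (a := x)))
      simp only [List.foldr_cons]
      omega
  exact this.of_raw_eq fun x => by cases f x <;> rfl

-- As with the predecessor in primitive recursion, the fold carries the list itself along with its
-- tail.
@[fun_prop] theorem PT.tail {f : γ → List α} (hf : PT f) : PT fun x => (f x).tail := by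
  have key : ∀ l : List α, l.foldr (fun x s => (s.2, x :: s.2)) ([], []) = (l.tail, l) := by
    intro l
    induction l with
    | nil => rfl
    | cons x l ih => simp [ih]
  have : PT fun c => (f c).foldr (fun x (s : List α × List α) => (s.2, x :: s.2)) ([], []) := by
    refine PT.foldr (B := fun c => 3 * sz (f c) + 1) hf (PT.const _) (by fun_prop)
      (((PB.const 3).mul hf.bound).add (PB.const 1)) ?_
    intro c suf hsuf
    have h1 : sz suf ≤ sz (f c) := by
      obtain ⟨t, ht⟩ := hsuf
      rw [← ht]
      simp
    have h2 : sz suf.tail ≤ sz suf := by cases suf <;> simp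
    rw [key, sz_pair]
    omega
  exact (PT.fst.comp this).of_raw_eq fun x => by rw [key]

@[fun_prop] theorem PT.isEmpty {f : γ → List α} (hf : PT f) : PT fun x => (f x).isEmpty := by
  have : PT fun c => (f c).foldr (fun _ _ => false) true :=
    PT.foldr (B := fun _ => 1) hf (PT.const _) (by fun_prop) (PB.const 1) fun _ _ _ => by simp
  exact this.of_raw_eq fun x => by cases f x <;> rfl

theorem PT.map {f : γ → List α} {h : γ → α → β} (hf : PT f)
    (hh : PT fun x : γ × α => h x.1 x.2) : PT fun c => (f c).map (h c) := by
  obtain ⟨q, hq⟩ := hh.bound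
  have hh' : PT fun x : γ × α × List β => h x.1 x.2.1 :=
    hh.comp (PT.fst.pair (PT.fst.comp PT.snd))
  have : PT fun c => (f c).foldr (fun x s => h c x :: s) [] := by
    refine PT.foldr_of_growth (K := fun c => 2 * q.eval (2 * sz c + 1 + sz (f c)) + 1) hf
      (PT.const _) (by fun_prop) sz 1 (by simp) (by simp) ?_ ?_
    · exact ((PB.const 2).mul (((((PB.const 2).mul PB.sz).add (PB.const 1)).add
        hf.bound).eval q)).add (PB.const 1)
    · intro c s x hx
      have h1 := sz_le_of_mem hx
      have h2 : sz (h c x) ≤ q.eval (2 * sz c + 1 + sz (f c)) :=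
        (hq (c, x)).trans (eval_mono q (by rw [sz_pair]; omega))
      rw [sz_cons]
      omega
  exact this.of_raw_eq fun x => by rw [List.map_eq_foldr]

theorem PT.all {f : γ → List α} {h : γ → α → Bool} (hf : PT f)
    (hh : PT fun x : γ × α => h x.1 x.2) : PT fun c => (f c).all (h c) := by
  have hh' : PT fun x : γ × α × Bool => h x.1 x.2.1 :=
    hh.comp (PT.fst.pair (PT.fst.comp PT.snd))
  have : PT fun c => (f c).foldr (fun x s => h c x && s) true :=
    PT.foldr (B := fun _ => 1) hf (PT.const _) (by fun_prop) (PB.const 1) fun _ _ _ => by simp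
  exact this.of_raw_eq fun x => by
    congr 1
    induction f x with
    | nil => rfl
    | cons y l ih => simp [ih]

theorem PT.any {f : γ → List α} {h : γ → α → Bool} (hf : PT f)
    (hh : PT fun x : γ × α => h x.1 x.2) : PT fun c => (f c).any (h c) := by
  have hh' : PT fun x : γ × α × Bool => h x.1 x.2.1 :=
    hh.comp (PT.fst.pair (PT.fst.comp PT.snd))
  have : PT fun c => (f c).foldr (fun x s => h c x || s) false :=
    PT.foldr (B := fun _ => 1) hf (PT.const _) (by fun_prop) (PB.const 1) fun _ _ _ => by simp
  exact this.of_raw_eq fun x => by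
    congr 1
    induction f x with
    | nil => rfl
    | cons y l ih => simp [ih]

theorem sz_tail_le (l : List α) : sz l.tail ≤ sz l := by
  cases l <;> simp

end

/-! ### Arithmetic -/

instance : Enc ℕ := ⟨fun n => raw n.bits⟩

section

variable {α : Type} [Enc α]

theorem sz_nat (n : ℕ) : sz n = 3 * n.size := by
  rw [← Nat.size_eq_bits_len]
  show sz n.bits = _
  induction n.bits with
  | nil => rfl
  | cons b l ih => simp [ih]; omega

theorem sz_nat_mono {m n : ℕ} (h : m ≤ n) : sz m ≤ sz n := by
  rw [sz_nat, sz_nat]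
  exact Nat.mul_le_mul_left _ (Nat.size_le_size h)

theorem sz_mul_le (m n : ℕ) : sz (m * n) ≤ sz m + sz n := by
  rw [sz_nat, sz_nat, sz_nat, ← Nat.mul_add]
  refine Nat.mul_le_mul_left _ (Nat.size_le.2 ?_)
  rw [pow_add]
  exact Nat.mul_lt_mul'' (Nat.lt_size_self m) (Nat.lt_size_self n)

theorem sz_add_le (m n : ℕ) : sz (m + n) ≤ max (sz m) (sz n) + 3 := by
  have h : (m + n).size ≤ max m.size n.size + 1 := by
    refine Nat.size_le.2 ?_
    have h1 : m < 2 ^ max m.size n.size :=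
      (Nat.lt_size_self m).trans_le (Nat.pow_le_pow_right (by norm_num) (le_max_left _ _))
    have h2 : n < 2 ^ max m.size n.size :=
      (Nat.lt_size_self n).trans_le (Nat.pow_le_pow_right (by norm_num) (le_max_right _ _))
    rw [pow_succ]
    omega
  simp only [sz_nat]
  omega

theorem sz_bit_le (b : Bool) (n : ℕ) : sz (Nat.bit b n) ≤ sz n + 3 := by
  have h : (Nat.bit b n).size ≤ n.size + 1 := by
    refine Nat.size_le.2 ?_
    have := Nat.lt_size_self n
    rw [pow_succ, Nat.bit_val]
    cases b <;> simp <;> omega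
  simp only [sz_nat]
  omega

@[fun_prop] theorem PT.bits {f : α → ℕ} (hf : PT f) : PT fun x => (f x).bits :=
  hf.of_raw_eq fun _ => rfl

@[fun_prop] theorem PT.bodd {f : α → ℕ} (hf : PT f) : PT fun x => (f x).bodd := by
  have : PT fun x => (f x).bits.headD false := by fun_prop
  exact this.of_raw_eq fun x => by
    rw [Nat.bodd_eq_bits_head]
    cases (f x).bits <;> rfl

@[fun_prop] theorem PT.div2 {f : α → ℕ} (hf : PT f) : PT fun x => (f x).div2 := by
  have : PT fun x => (f x).bits.tail := by fun_prop
  exact this.of_raw_eq fun x => congrArg raw (Nat.div2_bits_eq_tail _)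

/-- Whether a number is zero. -/
def isZero (n : ℕ) : Bool := n.bits.isEmpty

theorem isZero_iff (n : ℕ) : isZero n = true ↔ n = 0 := by
  rw [isZero, List.isEmpty_iff_length_eq_zero, Nat.size_eq_bits_len, Nat.size_eq_zero]

@[fun_prop] theorem PT.isZero {f : α → ℕ} (hf : PT f) : PT fun x => isZero (f x) := by
  unfold Manipulation.isZero
  fun_prop

@[fun_prop] theorem PT.bit {f : α → Bool} {g : α → ℕ} (hf : PT f) (hg : PT g) :
    PT fun x => Nat.bit (f x) (g x) := by
  -- Binary expansions have no leading zeros, so `Nat.bit false 0` must get the empty list.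
  have : PT fun x => bif !(f x) && Manipulation.isZero (g x) then [] else f x :: (g x).bits := by
    fun_prop
  refine this.of_raw_eq fun x => congrArg (raw (α := List Bool)) ?_
  by_cases h : g x = 0
  · have h0 : Manipulation.isZero (g x) = true := (isZero_iff _).2 h
    rw [h0, h]
    cases hb : f x
    · simp
    · rw [Nat.bits_append_bit _ _ fun _ => rfl]
      rfl
  · have h0 : Manipulation.isZero (g x) = false := by
      rw [← Bool.not_eq_true, isZero_iff]
      exact h
    rw [h0, Nat.bits_append_bit _ _ fun h' => absurd h' h]
    simp

/-- The number with the given binary digits, the least significant one first. -/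
def ofBits (l : List Bool) : ℕ := l.foldr Nat.bit 0

@[simp] theorem ofBits_bits (n : ℕ) : ofBits n.bits = n := by
  induction n using Nat.binaryRec' with
  | zero => simp [ofBits]
  | bit b n h ih =>
    rw [Nat.bits_append_bit _ _ h]
    exact congrArg (Nat.bit b) ih

theorem sz_ofBits_le (l : List Bool) : sz (ofBits l) ≤ sz l := by
  induction l with
  | nil => simp [ofBits, sz_nat]
  | cons b l ih =>
    have := sz_bit_le b (ofBits l)
    change sz (Nat.bit b (ofBits l)) ≤ _
    simp only [sz_cons, sz_bool]
    omega

@[fun_prop] theorem PT.ofBits {f : α → List Bool} (hf : PT f) : PT fun x => ofBits (f x) :=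
  PT.foldr_of_growth hf (PT.const 0) (by fun_prop) sz 1 (by simp) (by simp) (PB.const 3)
    fun _ s x _ => sz_bit_le x s

theorem sz_succ_le (n : ℕ) : sz (n + 1) ≤ sz n + 3 :=
  (sz_nat_mono (show n + 1 ≤ Nat.bit true n by rw [Nat.bit_val]; simp; omega)).trans (sz_bit_le _ _)

-- The fold carries `n` and `n + 1` together: the successor of `2n + 1` is `2(n + 1)`, that of `2n`
-- is `2n + 1`.
@[fun_prop] theorem PT.succ {f : α → ℕ} (hf : PT f) : PT fun x => f x + 1 := by
  have key : ∀ l : List Bool, l.foldr (fun b (s : ℕ × ℕ) =>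
      (Nat.bit b s.1, bif b then Nat.bit false s.2 else Nat.bit true s.1)) (0, 1) =
      (Manipulation.ofBits l, Manipulation.ofBits l + 1) := by
    intro l
    induction l with
    | nil => rfl
    | cons b l ih =>
      rw [List.foldr_cons, ih]
      cases b <;> (simp [Manipulation.ofBits, Nat.bit_val]; try ring)
  have : PT fun x => (f x).bits.foldr (fun b (s : ℕ × ℕ) =>
      (Nat.bit b s.1, bif b then Nat.bit false s.2 else Nat.bit true s.1)) (0, 1) := by
    refine PT.foldr (B := fun x => 3 * sz (f x) + 4) hf.bits (PT.const _) (by fun_prop)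
      (((PB.const 3).mul hf.bound).add (PB.const 4)) ?_
    intro x suf hsuf
    have h1 := sz_ofBits_le suf
    have h2 : sz suf ≤ sz (f x) := by
      change _ ≤ sz (f x).bits
      obtain ⟨t, ht⟩ := hsuf
      rw [← ht]
      simp
    have h3 := sz_succ_le (Manipulation.ofBits suf)
    rw [key, sz_pair]
    omega
  exact (PT.snd.comp this).of_raw_eq fun x => by rw [key, ofBits_bits]

/-- The digits of two numbers, most significant ones first, and the remaining part of the
second number. -/
def padZip (m n : ℕ) : List (Bool × Bool) × ℕ :=
  m.bits.foldl (fun s x => ((x, s.2.bodd) :: s.1, s.2.div2)) ([], n)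

theorem sz_div2_le (n : ℕ) : sz n.div2 ≤ sz n :=
  sz_nat_mono (by rw [Nat.div2_val]; omega)

theorem PT.padZip {f g : α → ℕ} (hf : PT f) (hg : PT g) : PT fun x => padZip (f x) (g x) := by
  refine PT.foldl_of_growth hf.bits ((PT.const []).pair hg) (by fun_prop) sz 1 (by simp) (by simp)
    (PB.const 20) ?_
  intro _ s x _
  have := sz_div2_le s.2
  rw [← Prod.mk.eta (p := s)]
  simp only [sz_pair, sz_cons, sz_bool]
  omega

/-- The computation of a function of two numbers from their binary digits. -/
theorem foldl_padZip {β : Type} (F : ℕ → ℕ → β) (h : β → Bool × Bool → β)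
    (hF : ∀ x y m n, F (Nat.bit x m) (Nat.bit y n) = h (F m n) (x, y)) (m n : ℕ) :
    (padZip m n).1.foldl h (F 0 (padZip m n).2) = F m n := by
  have key : ∀ (l : List Bool) (out : List (Bool × Bool)) (n : ℕ),
      (l.foldl (fun s x => ((x, s.2.bodd) :: s.1, s.2.div2)) (out, n)).1.foldl h
        (F 0 (l.foldl (fun (s : List (Bool × Bool) × ℕ) x =>
          ((x, s.2.bodd) :: s.1, s.2.div2)) (out, n)).2) = out.foldl h (F (ofBits l) n) := by
    intro l
    induction l with
    | nil => intro out n; rfl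
    | cons x l ih =>
      intro out n
      rw [List.foldl_cons, ih, List.foldl_cons, ← hF, Nat.bit_bodd_div2]
      rfl
  have h1 := key m.bits [] n
  rwa [ofBits_bits] at h1

/-- From the most significant digit downwards, carries from below are not yet known. So the state
consists of `m + n` and `m + n + 1` for the leading parts `m` and `n`. -/
def addStep (s : ℕ × ℕ) (x : Bool × Bool) : ℕ × ℕ :=
  bif x.1 && x.2 then (Nat.bit false s.2, Nat.bit true s.2)
  else bif x.1 || x.2 then (Nat.bit true s.1, Nat.bit false s.2)
  else (Nat.bit false s.1, Nat.bit true s.1)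

@[fun_prop] theorem PT.add {f g : α → ℕ} (hf : PT f) (hg : PT g) : PT fun x => f x + g x := by
  have hz := hf.padZip hg
  have h1 : PT fun x => (Manipulation.padZip (f x) (g x)).1.foldl addStep
      (0 + (Manipulation.padZip (f x) (g x)).2, 0 + (Manipulation.padZip (f x) (g x)).2 + 1) := by
    simp only [Nat.zero_add]
    refine PT.foldl_of_growth (h := fun _ => addStep) (PT.fst.comp hz)
      ((PT.snd.comp hz).pair (PT.snd.comp hz).succ) ?_
      (fun s => max (sz s.1) (sz s.2)) 3 ?_ ?_ (PB.const 3) ?_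
    · unfold addStep
      fun_prop
    · rintro ⟨a, b⟩
      simp only [sz_pair]
      omega
    · rintro ⟨a, b⟩
      simp only [sz_pair]
      omega
    · rintro _ ⟨a, b⟩ ⟨x, y⟩ -
      have h1 := sz_bit_le true a
      have h2 := sz_bit_le false a
      have h3 := sz_bit_le true b
      have h4 := sz_bit_le false b
      cases x <;> cases y <;> simp only [addStep, Bool.and_true, Bool.and_false, Bool.or_true,
        Bool.or_false, cond_true, cond_false] <;> omega
  refine (PT.fst.comp h1).of_raw_eq fun x => ?_
  rw [foldl_padZip (fun m n => (m + n, m + n + 1)) addStep]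
  rintro (_ | _) (_ | _) m n <;> simp [addStep, Nat.bit_val] <;> omega

/-- Comparison of natural numbers. -/
def natLe (m n : ℕ) : Bool := decide (m ≤ n)

/-- The state is the pair of truth values of `m ≤ n` and `m < n` for the leading parts; neither can
be updated without the other. -/
def leStep (s : Bool × Bool) (x : Bool × Bool) : Bool × Bool :=
  (bif x.1 && !x.2 then s.2 else s.1, bif !x.1 && x.2 then s.1 else s.2)

@[fun_prop] theorem PT.natLe {f g : α → ℕ} (hf : PT f) (hg : PT g) :
    PT fun x => natLe (f x) (g x) := by
  have hz := hf.padZip hg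
  have h1 : PT fun x => (Manipulation.padZip (f x) (g x)).1.foldl leStep
      (true, !(Manipulation.isZero (Manipulation.padZip (f x) (g x)).2)) := by
    refine PT.foldl (h := fun _ => leStep) (B := fun _ => 4) (PT.fst.comp hz)
      ((PT.const _).pair (PT.snd.comp hz).isZero.not) ?_ (PB.const 4) ?_
    · unfold leStep
      fun_prop
    · intro c pre _
      rw [← Prod.mk.eta (p := List.foldl _ _ _), sz_pair, sz_bool, sz_bool]
  refine (PT.fst.comp h1).of_raw_eq fun x => ?_
  have h2 := foldl_padZip (fun m n => (decide (m ≤ n), decide (m < n))) leStep ?_ (f x) (g x)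
  · have h3 : (!(Manipulation.isZero (Manipulation.padZip (f x) (g x)).2)) =
        decide (0 < (Manipulation.padZip (f x) (g x)).2) := by
      rw [Bool.eq_iff_iff, Bool.not_eq_true', ← Bool.not_eq_true, isZero_iff, decide_eq_true_iff,
        Nat.pos_iff_ne_zero]
    simp only [Nat.zero_le, decide_true] at h2
    rw [h3, h2]
    rfl
  · rintro (_ | _) (_ | _) m n <;> simp [leStep, Nat.bit_val] <;> omega

/-- Equality of natural numbers. -/
def natEq (m n : ℕ) : Bool := natLe m n && natLe n m

theorem natEq_iff (m n : ℕ) : natEq m n = true ↔ m = n := by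
  simp only [natEq, natLe, Bool.and_eq_true, decide_eq_true_iff]
  omega

@[fun_prop] theorem PT.natEq {f g : α → ℕ} (hf : PT f) (hg : PT g) :
    PT fun x => natEq (f x) (g x) := by
  unfold Manipulation.natEq
  fun_prop

-- Horner's scheme: each intermediate value is a leading part of `f x` times `g x`, hence no longer
-- than both factors together.
@[fun_prop] theorem PT.mul {f g : α → ℕ} (hf : PT f) (hg : PT g) : PT fun x => f x * g x := by
  have key : ∀ (l : List Bool) (n : ℕ), l.foldr (fun b s =>
      bif b then Nat.bit false s + n else Nat.bit false s) 0 = Manipulation.ofBits l * n := by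
    intro l n
    induction l with
    | nil => simp [Manipulation.ofBits]
    | cons b l ih =>
      rw [List.foldr_cons, ih]
      cases b <;> simp [Manipulation.ofBits, Nat.bit_val] <;> ring
  have : PT fun x => (f x).bits.foldr (fun b s =>
      bif b then Nat.bit false s + g x else Nat.bit false s) 0 := by
    have hg' : PT fun x : α × Bool × ℕ => g x.1 := hg.comp PT.fst
    refine PT.foldr (B := fun x => sz (f x) + sz (g x)) hf.bits (PT.const _) (by fun_prop)
      (hf.bound.add hg.bound) ?_
    intro x suf hsuf
    have h1 := sz_ofBits_le suf
    have h2 : sz suf ≤ sz (f x) := by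
      change _ ≤ sz (f x).bits
      obtain ⟨t, ht⟩ := hsuf
      rw [← ht]
      simp
    have h3 := sz_mul_le (Manipulation.ofBits suf) (g x)
    rw [key]
    omega
  exact this.of_raw_eq fun x => by rw [key, ofBits_bits]

/-! ### Fractions -/

instance : Enc ℕ+ := ⟨fun n => raw (n : ℕ)⟩

theorem sz_pnat (n : ℕ+) : sz n = sz (n : ℕ) := rfl

@[fun_prop] theorem PT.pnatCoe {f : α → ℕ+} (hf : PT f) : PT fun x => (f x : ℕ) :=
  hf.of_raw_eq fun _ => rfl

@[fun_prop] theorem PT.pnatMul {f g : α → ℕ+} (hf : PT f) (hg : PT g) : PT fun x => f x * g x := by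
  have : PT fun x => (f x : ℕ) * (g x : ℕ) := by fun_prop
  exact this.of_raw_eq fun _ => rfl

@[fun_prop] theorem PT.toPNat' {f : α → ℕ} (hf : PT f) : PT fun x => (f x).toPNat' := by
  have : PT fun x => bif Manipulation.isZero (f x) then 1 else f x := by fun_prop
  refine this.of_raw_eq fun x => congrArg (raw (α := ℕ)) ?_
  rw [Nat.toPNat'_coe]
  by_cases h : f x = 0
  · rw [(isZero_iff _).2 h, h]
    rfl
  · have h0 : Manipulation.isZero (f x) = false := by
      rw [← Bool.not_eq_true, isZero_iff]
      exact h
    rw [h0, if_pos (Nat.pos_of_ne_zero h)]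
    rfl

/-- The fraction `(a - b) / d`, not necessarily in lowest terms, as the triple `(a, b, d)`. -/
abbrev Frac : Type := ℕ × ℕ × ℕ+

namespace Frac

/-- The value of a fraction. -/
def val (x : Frac) : ℚ := ((x.1 : ℚ) - x.2.1) / (x.2.2 : ℕ)

def zero : Frac := (0, 0, 1)

def add (x y : Frac) : Frac :=
  (x.1 * y.2.2 + y.1 * x.2.2, x.2.1 * y.2.2 + y.2.1 * x.2.2, x.2.2 * y.2.2)

def neg (x : Frac) : Frac := (x.2.1, x.1, x.2.2)

def smul (k : ℕ) (x : Frac) : Frac := (k * x.1, k * x.2.1, x.2.2)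

/-- Cross-multiplication with the subtracted parts moved to the other side, so that only natural
numbers are compared. -/
def le (x y : Frac) : Bool :=
  natLe (x.1 * y.2.2 + y.2.1 * x.2.2) (y.1 * x.2.2 + x.2.1 * y.2.2)

/-- The larger one of a fraction and zero. -/
def pos (x : Frac) : Frac := bif le zero x then x else zero

def sum (l : List Frac) : Frac := l.foldl add zero

theorem den_pos (x : Frac) : (0 : ℚ) < (x.2.2 : ℕ) := by exact_mod_cast x.2.2.pos

@[simp] theorem val_zero : val zero = 0 := by simp [val, zero]

@[simp] theorem val_add (x y : Frac) : val (add x y) = val x + val y := by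
  have hx := (den_pos x).ne'
  have hy := (den_pos y).ne'
  simp only [val, add, PNat.mul_coe]
  push_cast
  field_simp
  ring

@[simp] theorem val_neg (x : Frac) : val (neg x) = -val x := by
  simp only [val, neg]
  ring

@[simp] theorem val_smul (k : ℕ) (x : Frac) : val (smul k x) = k * val x := by
  simp only [val, smul]
  push_cast
  ring

@[simp] theorem le_iff (x y : Frac) : le x y = true ↔ val x ≤ val y := by
  have hx := den_pos x
  have hy := den_pos y
  simp only [le, natLe, decide_eq_true_iff, val]
  rw [div_le_div_iff₀ hx hy, ← @Nat.cast_le ℚ]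
  push_cast
  constructor <;> intro h <;> linarith

@[simp] theorem val_pos (x : Frac) : val (pos x) = max (val x) 0 := by
  have h := le_iff zero x
  rw [val_zero] at h
  unfold pos
  by_cases hx : 0 ≤ val x
  · rw [h.2 hx, max_eq_left hx]
    rfl
  · have h' : le zero x = false := by
      rw [← Bool.not_eq_true, h]
      exact hx
    rw [h', max_eq_right (le_of_not_ge hx)]
    exact val_zero

@[simp] theorem val_sum (l : List Frac) : val (sum l) = (l.map val).sum := by
  have key : ∀ (l : List Frac) (x : Frac), val (l.foldl add x) = val x + (l.map val).sum := by
    intro l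
    induction l with
    | nil => simp
    | cons y l ih =>
      intro x
      rw [List.foldl_cons, ih]
      simp
      ring
  simp [sum, key]

end Frac

@[fun_prop] theorem PT.fracAdd {f g : α → Frac} (hf : PT f) (hg : PT g) :
    PT fun x => Frac.add (f x) (g x) := by
  unfold Frac.add
  fun_prop

@[fun_prop] theorem PT.fracNeg {f : α → Frac} (hf : PT f) : PT fun x => Frac.neg (f x) := by
  unfold Frac.neg
  fun_prop

@[fun_prop] theorem PT.fracSmul {f : α → ℕ} {g : α → Frac} (hf : PT f) (hg : PT g) :
    PT fun x => Frac.smul (f x) (g x) := by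
  unfold Frac.smul
  fun_prop

@[fun_prop] theorem PT.fracLe {f g : α → Frac} (hf : PT f) (hg : PT g) :
    PT fun x => Frac.le (f x) (g x) := by
  unfold Frac.le
  fun_prop

@[fun_prop] theorem PT.fracPos {f : α → Frac} (hf : PT f) : PT fun x => Frac.pos (f x) := by
  unfold Frac.pos
  fun_prop

-- Fractions are never reduced, but multiplying by a denominator only adds lengths: a summand
-- increases each entry by at most its own size and one carry digit, which costs 3.
@[fun_prop] theorem PT.fracSum {f : α → List Frac} (hf : PT f) : PT fun x => Frac.sum (f x) := by
  refine PT.foldl_of_growth (h := fun _ => Frac.add) (K := fun x => sz (f x) + 3) hf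
    (PT.const Frac.zero) (by fun_prop) (fun s => max (sz s.1) (max (sz s.2.1) (sz s.2.2))) 5
    ?_ ?_ (hf.bound.add (PB.const 3)) ?_
  · rintro ⟨a, b, d⟩
    simp only [sz_pair]
    omega
  · rintro ⟨a, b, d⟩
    simp only [sz_pair]
    omega
  · rintro c ⟨a, b, d⟩ ⟨a', b', d'⟩ hx
    have h0 := sz_le_of_mem hx
    simp only [sz_pair] at h0
    simp only [Frac.add, sz_pnat, PNat.mul_coe] at h0 ⊢
    have h1 := sz_mul_le a d'
    have h2 := sz_mul_le a' d
    have h3 := sz_mul_le b d'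
    have h4 := sz_mul_le b' d
    have h5 := sz_mul_le d d'
    have h6 := sz_add_le (a * d') (a' * d)
    have h7 := sz_add_le (b * d') (b' * d)
    omega

end

/-! ### Reading the input -/

section

variable {α β : Type} [Enc α] [Enc β]

/-- The state of the parser: the rows, the current row, and the sign and the digits of the current
number, all of them in reverse order. -/
abbrev ParseState : Type := List (List (Bool × ℕ)) × List (Bool × ℕ) × Bool × List Bool

/-- The number with the given binary digits, the most significant one first. -/
def ofDigits (l : List Bool) : ℕ := ofBits l.reverse

/-- The three tests single out a digit, then separate the bar from the other signs, then the minus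
from the comma. Comma and bar close a number and a row. -/
def parseStep (s : ParseState) (l : Letter) : ParseState :=
  bif l.triple.1 then (s.1, s.2.1, s.2.2.1, l.triple.2.1 :: s.2.2.2)
  else bif l.triple.2.1 then
    bif l.triple.2.2 then (s.1, s.2.1, true, s.2.2.2)
    else (s.1, (s.2.2.1, ofDigits s.2.2.2) :: s.2.1, false, [])
  else (s.2.1.reverse :: s.1, [], false, [])

/-- The rows of integers in the input, each integer as its sign and its absolute value. -/
def parse (l : List Letter) : List (List (Bool × ℕ)) :=
  (l.foldl parseStep ([], [], false, [])).1.reverse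

@[fun_prop] theorem PT.letterTriple {f : α → Letter} (hf : PT f) : PT fun x => (f x).triple :=
  PT.triple.comp hf

@[fun_prop] theorem PT.ofDigits {f : α → List Bool} (hf : PT f) : PT fun x => ofDigits (f x) := by
  unfold Manipulation.ofDigits
  fun_prop

theorem PT.parseStep : PT fun x : ParseState × Letter => parseStep x.1 x.2 := by
  unfold Manipulation.parseStep
  fun_prop

theorem PT.parse_id : PT parse := by
  have : PT fun l : List Letter => l.foldl Manipulation.parseStep ([], [], false, []) := by
    have h := PT.parseStep.comp (show PT fun x : List Letter × Letter × ParseState =>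
      (x.2.2, x.2.1) by fun_prop)
    refine PT.foldl_of_growth (h := fun _ => Manipulation.parseStep) PT.id (PT.const _) h
      -- Becoming an entry of a list doubles a code. With weights 4, 2 and 1, closing a number or a
      -- row therefore raises the measure only by a constant.
      (fun s => sz s.1 + 2 * sz s.2.1 + 4 * sz s.2.2.2) 10 ?_ ?_ (PB.const 20) ?_
    · rintro ⟨r, u, b, d⟩
      simp only [sz_pair]
      omega
    · rintro ⟨r, u, b, d⟩
      simp only [sz_pair, sz_bool]
      omega
    · rintro _ ⟨r, u, b, d⟩ l -
      have h1 := sz_ofBits_le d.reverse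
      rw [sz_reverse] at h1
      rcases l with b | _ | _ | _ <;>
        simp only [Manipulation.parseStep, Letter.triple, Manipulation.ofDigits, cond_true,
          cond_false, sz_cons, sz_pair, sz_bool, sz_reverse, sz_nil] <;> omega
  exact (PT.fst.comp this).reverse

/-- The parsed form of an integer. -/
def ofInt (z : ℤ) : Bool × ℕ := (decide (z < 0), z.natAbs)

theorem foldl_parseStep_bits (l : List Bool) (r : List (List (Bool × ℕ))) (u : List (Bool × ℕ))
    (b : Bool) (d : List Bool) :
    (l.map Letter.bit).foldl parseStep (r, u, b, d) = (r, u, b, l.reverse ++ d) := by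
  induction l generalizing d with
  | nil => rfl
  | cons x l ih =>
    rw [List.map_cons, List.foldl_cons]
    refine (ih (x :: d)).trans ?_
    simp

theorem foldl_parseStep_writeInt (z : ℤ) (r : List (List (Bool × ℕ))) (u : List (Bool × ℕ)) :
    (writeInt z).foldl parseStep (r, u, false, []) = (r, ofInt z :: u, false, []) := by
  have h : ∀ b, ((z.natAbs.bits.map Letter.bit ++ [Letter.comma]).foldl parseStep (r, u, b, [])) =
      (r, (b, z.natAbs) :: u, false, []) := by
    intro b
    rw [List.foldl_append, foldl_parseStep_bits]
    simp [parseStep, Letter.triple, ofDigits]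
  unfold writeInt ofInt
  by_cases hz : z < 0
  · rw [if_pos hz, List.append_assoc, decide_eq_true hz]
    exact h true
  · rw [if_neg hz]
    simpa [hz] using h false

theorem foldl_parseStep_flatMap (l : List ℤ) (r : List (List (Bool × ℕ)))
    (u : List (Bool × ℕ)) :
    (l.flatMap writeInt).foldl parseStep (r, u, false, []) =
      (r, (l.map ofInt).reverse ++ u, false, []) := by
  induction l generalizing u with
  | nil => rfl
  | cons z l ih =>
    rw [List.flatMap_cons, List.foldl_append, foldl_parseStep_writeInt, ih]
    simp

theorem foldl_parseStep_writeRows (L : List (List ℤ)) (r : List (List (Bool × ℕ))) :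
    (writeRows L).foldl parseStep (r, [], false, []) =
      ((L.map (List.map ofInt)).reverse ++ r, [], false, []) := by
  induction L generalizing r with
  | nil => rfl
  | cons l L ih =>
    have h : (writeRow l).foldl parseStep (r, [], false, []) =
        (l.map ofInt :: r, [], false, []) := by
      rw [writeRow, List.foldl_append, foldl_parseStep_flatMap]
      simp [parseStep, Letter.triple]
    rw [writeRows, List.flatMap_cons, List.foldl_append, h]
    refine (ih _).trans ?_
    simp

theorem parse_writeRows (L : List (List ℤ)) : parse (writeRows L) = L.map (List.map ofInt) := by
  rw [parse, foldl_parseStep_writeRows]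
  simp

/-- The numbers in a row. -/
def nats (l : List (Bool × ℕ)) : List ℕ := l.map Prod.snd

@[fun_prop] theorem PT.nats {f : α → List (Bool × ℕ)} (hf : PT f) : PT fun x => nats (f x) :=
  PT.map (h := fun _ => Prod.snd) hf (by fun_prop)

/-- One step of reading a list of fractions, from right to left. -/
def fracStep (x : Bool × ℕ) (s : (Bool × ℕ) × List Frac) : (Bool × ℕ) × List Frac :=
  -- The flag says that a denominator is pending; from the right it is met before its numerator.
  bif s.1.1 then ((false, 0),
    (bif x.1 then (0, x.2, s.1.2.toPNat') else (x.2, 0, s.1.2.toPNat')) :: s.2)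
  else ((true, x.2), s.2)

/-- The fractions in a row of numerators and denominators. -/
def fracs (l : List (Bool × ℕ)) : List Frac := (l.foldr fracStep ((false, 0), [])).2

theorem sz_toPNat'_le (n : ℕ) : sz n.toPNat' ≤ sz n + 3 := by
  rw [sz_pnat]
  refine le_trans (sz_nat_mono ?_) (sz_succ_le n)
  rw [Nat.toPNat'_coe]
  split_ifs <;> omega

@[fun_prop] theorem PT.fracs {f : α → List (Bool × ℕ)} (hf : PT f) : PT fun x => fracs (f x) := by
  have : PT fun x => (f x).foldr fracStep ((false, 0), []) := by
    refine PT.foldr_of_growth (h := fun _ => fracStep) (K := fun x => 20 * sz (f x) + 20) hf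
      (PT.const _) ?_ (fun s => 2 * sz s.1.2 + sz s.2) 10 ?_ ?_
      (((PB.const 20).mul hf.bound).add (PB.const 20)) ?_
    · unfold fracStep
      fun_prop
    · rintro ⟨⟨b, n⟩, l⟩
      simp only [sz_pair]
      omega
    · rintro ⟨⟨b, n⟩, l⟩
      simp only [sz_pair, sz_bool]
      omega
    · rintro c ⟨⟨b, n⟩, l⟩ ⟨b', n'⟩ hx
      have h1 := sz_le_of_mem hx
      have h2 := sz_toPNat'_le n
      have h3 : sz (0 : ℕ) = 0 := rfl
      rw [sz_pair, sz_bool] at h1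
      cases b <;> cases b' <;>
        simp only [fracStep, cond_true, cond_false, sz_cons, sz_pair] <;> omega
  exact PT.snd.comp this

theorem map_val_fracs (l : List ℚ) :
    (fracs ((l.flatMap fun q => [q.num, (q.den : ℤ)]).map ofInt)).map Frac.val = l := by
  have key : ∀ l : List ℚ, ∃ F : List Frac,
      ((l.flatMap fun q => [q.num, (q.den : ℤ)]).map ofInt).foldr fracStep ((false, 0), []) =
        ((false, 0), F) ∧ F.map Frac.val = l := by
    intro l
    induction l with
    | nil => exact ⟨[], rfl, rfl⟩
    | cons q l ih =>
      obtain ⟨F, h1, h2⟩ := ih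
      have hd : ((q.den.toPNat' : ℕ+) : ℕ) = q.den := by
        rw [Nat.toPNat'_coe, if_pos q.den_pos]
      simp only [List.flatMap_cons, List.cons_append, List.nil_append, List.map_cons,
        List.foldr_cons, h1]
      refine ⟨_, rfl, ?_⟩
      rw [List.map_cons]
      change _ :: F.map Frac.val = _
      rw [h2]
      congr 1
      change Frac.val (bif (ofInt q.num).1 then (0, (ofInt q.num).2, q.den.toPNat')
        else ((ofInt q.num).2, 0, q.den.toPNat')) = q
      simp only [ofInt]
      by_cases hq : q.num < 0
      · have h3 : ((q.num.natAbs : ℕ) : ℚ) = -(q.num : ℚ) := by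
          rw [← Int.cast_natCast, Int.ofNat_natAbs_of_nonpos hq.le, Int.cast_neg]
        simp [hq, Frac.val, hd, h3, Rat.num_div_den]
      · have h3 : ((q.num.natAbs : ℕ) : ℚ) = (q.num : ℚ) := by
          rw [← Int.cast_natCast, Int.natAbs_of_nonneg (not_lt.1 hq)]
        simp [hq, Frac.val, hd, h3, Rat.num_div_den]
  obtain ⟨F, h1, h2⟩ := key l
  rw [fracs, h1]
  exact h2

/-! ### The algorithm -/

/-- The value that belongs to the key `c`. -/
def lookup (d : β) (c : ℕ) (ks : List ℕ) (vs : List β) : β :=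
  (ks.foldl (fun s x => (s.1.tail, bif natEq x c then s.1.headD d else s.2)) (vs, d)).2

theorem PT.lookup {d : β} {f : α → ℕ} {g : α → List ℕ} {h : α → List β} (hf : PT f) (hg : PT g)
    (hh : PT h) : PT fun x => lookup d (f x) (g x) (h x) := by
  have : PT fun x => (g x).foldl
      (fun (s : List β × β) y => (s.1.tail, bif Manipulation.natEq y (f x) then s.1.headD d else s.2))
      (h x, d) := by
    refine PT.foldl (B := fun x => 3 * (sz (h x) + sz d) + 1) hg (hh.pair (PT.const d))
      (by fun_prop) (((PB.const 3).mul (hh.bound.add (PB.const _))).add (PB.const 1)) ?_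
    intro c pre _
    have key : ∀ (l : List ℕ) (s : List β × β) (n : ℕ), sz s.1 + sz d ≤ n → sz s.2 ≤ n →
        sz (l.foldl (fun (s : List β × β) y =>
          (s.1.tail, bif Manipulation.natEq y (f c) then s.1.headD d else s.2)) s) ≤ 3 * n + 1 := by
      intro l
      induction l with
      | nil =>
        rintro ⟨a, b⟩ n h1 h2
        simp only [List.foldl_nil, sz_pair] at *
        omega
      | cons x l ih =>
        rintro ⟨a, b⟩ n h1 h2
        refine ih _ n ?_ ?_
        · have := sz_tail_le a
          dsimp only at *
          omega
        · cases hx : Manipulation.natEq x (f c)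
          · simpa [hx] using h2
          · cases a <;> simp [hx] at * <;> omega
    refine (key pre _ (sz (h c) + sz d) le_rfl (by simp)).trans ?_
    omega
  exact PT.snd.comp this

omit [Enc β] in
theorem foldl_lookup_of_notMem (d : β) (c : ℕ) (ks : List ℕ) (s : List β × β) (hc : c ∉ ks) :
    (ks.foldl (fun s x => (s.1.tail, bif natEq x c then s.1.headD d else s.2)) s).2 = s.2 := by
  induction ks generalizing s with
  | nil => rfl
  | cons x ks ih =>
    rw [List.mem_cons, not_or] at hc
    have : natEq x c = false := by
      rw [← Bool.not_eq_true, natEq_iff]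
      exact fun h => hc.1 h.symm
    rw [List.foldl_cons, ih _ hc.2, this]
    rfl

omit [Enc β] in
-- The fold keeps the last match, so the keys must be distinct for the value at position `i` to
-- survive.
theorem lookup_getElem (d : β) (ks : List ℕ) (vs : List β) (hks : ks.Nodup) (i : ℕ)
    (hi : i < ks.length) (hi' : i < vs.length) : lookup d ks[i] ks vs = vs[i] := by
  have key : ∀ (ks : List ℕ) (vs : List β) (r : β) (i : ℕ) (hi : i < ks.length)
      (hi' : i < vs.length), ks.Nodup →
      (ks.foldl (fun s x => (s.1.tail, bif natEq x ks[i] then s.1.headD d else s.2))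
        (vs, r)).2 = vs[i] := by
    intro ks
    induction ks with
    | nil => intro _ _ _ hi; simp at hi
    | cons x ks ih =>
      intro vs r i hi hi' hks
      rw [List.nodup_cons] at hks
      cases vs with
      | nil => simp at hi'
      | cons y vs =>
        cases i with
        | zero =>
          rw [List.getElem_cons_zero, List.foldl_cons, foldl_lookup_of_notMem d x ks _ hks.1,
            (natEq_iff x x).2 rfl]
          rfl
        | succ i =>
          simp only [List.getElem_cons_succ, List.foldl_cons, List.tail_cons]
          exact ih vs _ i (by simpa using hi) (by simpa using hi') hks.2
  exact key ks vs d i hi hi' hks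

/-- The points that the candidate `c` gets from the vote `v`. -/
def pointsOf (A : List Frac) (c : ℕ) (v : List ℕ) : Frac := lookup Frac.zero c v A

/-- The score of the candidate `c`. -/
def total (A : List Frac) (P : List (List ℕ)) (c : ℕ) : Frac :=
  Frac.sum (P.map fun v => pointsOf A c v)

/-- Whether `a` comes before `b` in the list `t`. -/
def before (t : List ℕ) (a b : ℕ) : Bool :=
  -- Testing `a` first makes the relation reflexive on `t`, as needed when `isWinner` compares `x`
  -- with itself.
  t.foldr (fun z s => bif natEq z a then true else bif natEq z b then false else s) false

/-- Whether `x ≤ y`, with equality allowed only if `w` holds. -/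
def below (w : Bool) (x y : Frac) : Bool := bif w then Frac.le x y else !(Frac.le y x)

/-- Whether `x` is the winner. -/
def isWinner (A : List Frac) (t : List ℕ) (P : List (List ℕ)) (x : ℕ) : Bool :=
  t.all fun d => below (before t x d) (total A P d) (total A P x)

/-- The advantage that `y` gains over `x`, when the voter with the vote `v` puts `x` first and
`y` second. -/
def gain (A : List Frac) (x y : ℕ) (v : List ℕ) : Frac :=
  Frac.add (Frac.add (A.tail.headD Frac.zero) (Frac.neg (A.headD Frac.zero)))
    (Frac.add (pointsOf A x v) (Frac.neg (pointsOf A y v)))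

/-- An upper bound for the sum of `k` of the fractions in `l`, for each threshold `τ`. -/
def relaxedSum (k : ℕ) (l : List Frac) (τ : Frac) : Frac :=
  Frac.add (Frac.smul k τ) (Frac.sum (l.map fun g => Frac.pos (Frac.add g (Frac.neg τ))))

/-- Whether `k` voters can make `y` overtake `x`. -/
def canOvertake (A : List Frac) (t : List ℕ) (P : List (List ℕ)) (k x y : ℕ) : Bool :=
  (Frac.zero :: P.map fun v => gain A x y v).all fun τ => !(Frac.le Frac.zero τ) ||
    below (before t y x) (Frac.add (total A P x) (Frac.neg (total A P y)))
      (relaxedSum k (P.map fun v => gain A x y v) τ)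

/-- Whether there is a coalition against `y` with at most `k` members. -/
def solveFor (A : List Frac) (t : List ℕ) (P : List (List ℕ)) (k y : ℕ) : Bool :=
  t.any fun x => isWinner A t P x && (!(natEq x y) && canOvertake A t P k x y)

/-- The decision algorithm for CPMSW. -/
def solveCPMSW (l : List Letter) : Bool :=
  solveFor (fracs ((parse l).tail.headD [])) (nats ((parse l).tail.tail.headD []))
    ((parse l).tail.tail.tail.map fun r => nats r)
    (((parse l).headD []).tail.headD (false, 0)).2 (((parse l).headD []).headD (false, 0)).2

/-- The decision algorithm for CPMS. -/
def solveCPMS (l : List Letter) : Bool :=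
  (nats ((parse l).tail.tail.headD [])).any fun y =>
    solveFor (fracs ((parse l).tail.headD [])) (nats ((parse l).tail.tail.headD []))
      ((parse l).tail.tail.tail.map fun r => nats r) (((parse l).headD []).headD (false, 0)).2 y

/-! ### Polynomial running time of the algorithm -/

variable {A : α → List Frac} {t : α → List ℕ} {P : α → List (List ℕ)} {k x y : α → ℕ}

@[fun_prop] theorem PT.pointsOf {v : α → List ℕ} (hA : PT A) (hx : PT x) (hv : PT v) :
    PT fun i => pointsOf (A i) (x i) (v i) := PT.lookup hx hv hA

@[fun_prop] theorem PT.total (hA : PT A) (hP : PT P) (hx : PT x) :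
    PT fun i => total (A i) (P i) (x i) := by
  unfold Manipulation.total
  exact (PT.map (h := fun i v => Manipulation.pointsOf (A i) (x i) v) hP (by fun_prop)).fracSum

@[fun_prop] theorem PT.before (ht : PT t) (hx : PT x) (hy : PT y) :
    PT fun i => before (t i) (x i) (y i) :=
  PT.foldr (h := fun i z s => bif Manipulation.natEq z (x i) then true else
    bif Manipulation.natEq z (y i) then false else s) (B := fun _ => 1) ht (PT.const _)
    (by fun_prop) (PB.const 1) fun _ _ _ => by simp

@[fun_prop] theorem PT.below {w : α → Bool} {f g : α → Frac} (hw : PT w) (hf : PT f) (hg : PT g) :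
    PT fun i => below (w i) (f i) (g i) := by
  unfold Manipulation.below
  fun_prop

@[fun_prop] theorem PT.isWinner (hA : PT A) (ht : PT t) (hP : PT P) (hx : PT x) :
    PT fun i => isWinner (A i) (t i) (P i) (x i) :=
  PT.all ht (by fun_prop)

@[fun_prop] theorem PT.gain {v : α → List ℕ} (hA : PT A) (hx : PT x) (hy : PT y) (hv : PT v) :
    PT fun i => gain (A i) (x i) (y i) (v i) := by
  unfold Manipulation.gain
  fun_prop

@[fun_prop] theorem PT.relaxedSum {l : α → List Frac} {τ : α → Frac} (hk : PT k) (hl : PT l)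
    (hτ : PT τ) : PT fun i => relaxedSum (k i) (l i) (τ i) := by
  have h1 := (PT.map (h := fun i g => Frac.pos (Frac.add g (Frac.neg (τ i)))) hl
    (by fun_prop)).fracSum
  unfold Manipulation.relaxedSum
  fun_prop

@[fun_prop] theorem PT.canOvertake (hA : PT A) (ht : PT t) (hP : PT P) (hk : PT k) (hx : PT x)
    (hy : PT y) : PT fun i => canOvertake (A i) (t i) (P i) (k i) (x i) (y i) := by
  have h1 : PT fun i => (P i).map fun v => Manipulation.gain (A i) (x i) (y i) v :=
    PT.map hP (by fun_prop)
  refine PT.all ((PT.const Frac.zero).cons h1) ?_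
  have h2 := h1.comp (PT.fst (β := Frac))
  fun_prop

@[fun_prop] theorem PT.solveFor (hA : PT A) (ht : PT t) (hP : PT P) (hk : PT k) (hy : PT y) :
    PT fun i => solveFor (A i) (t i) (P i) (k i) (y i) :=
  PT.any ht (by fun_prop)

@[fun_prop] theorem PT.parse {f : α → List Letter} (hf : PT f) :
    PT fun i => parse (f i) := PT.parse_id.comp hf

theorem PT.solveCPMSW : PT solveCPMSW := by
  have h1 : PT fun l => (Manipulation.parse l).tail.tail.tail.map fun r => Manipulation.nats r :=
    PT.map (h := fun _ r => Manipulation.nats r) (by fun_prop) (by fun_prop)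
  unfold Manipulation.solveCPMSW
  fun_prop

theorem PT.solveCPMS : PT solveCPMS := by
  have h1 : PT fun l => (Manipulation.parse l).tail.tail.tail.map fun r => Manipulation.nats r :=
    PT.map (h := fun _ r => Manipulation.nats r) (by fun_prop) (by fun_prop)
  have h2 := h1.comp (PT.fst (β := ℕ))
  exact PT.any (by fun_prop) (by fun_prop)

end

/-! ### Winners and coalitions -/

section

variable {m : ℕ} {V : Type} [Fintype V]

/-- The candidate `x` has maximum score, and `t` prefers it to the others with this score. -/
def ScoringVector.IsTop (s : ScoringVector m) (t : Preference m) (P : V → Preference m)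
    (x : Fin m) : Prop :=
  ∀ d, s.score P d ≤ s.score P x ∧ (s.score P d = s.score P x → t x ≤ t d)

theorem ScoringVector.isTop_winner (s : ScoringVector m) (t : Preference m)
    (P : V → Preference m) : s.IsTop t P (s.winner t P) := by
  have hS := s.cowinners_nonempty P
  have h1 := Finset.min'_mem _ (hS.image t)
  obtain ⟨x, hx, hxt⟩ := Finset.mem_image.1 h1
  have hw : s.winner t P = x := by
    rw [winner, tieBreak, ← hxt, Equiv.symm_apply_apply]
  have hx' : ∀ d, s.score P d ≤ s.score P x := by simpa [cowinners] using hx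
  intro d
  rw [hw]
  refine ⟨hx' d, fun hd => ?_⟩
  rw [hxt]
  refine Finset.min'_le _ _ (Finset.mem_image_of_mem t ?_)
  simpa [cowinners, hd] using hx'

theorem ScoringVector.IsTop.winner_eq {s : ScoringVector m} {t : Preference m}
    {P : V → Preference m} {x : Fin m} (h : s.IsTop t P x) : s.winner t P = x := by
  have h' := s.isTop_winner t P
  have he := le_antisymm (h (s.winner t P)).1 (h' x).1
  exact t.injective (le_antisymm ((h' x).2 he.symm) ((h _).2 he))

/-- The advantage that `y` gains over `x`, when the voter `v` puts `x` first and `y` second. -/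
def ScoringVector.gain (s : ScoringVector m) (P : V → Preference m) (x y : Fin m) (v : V) : ℚ :=
  s.α ⟨1, s.two_le⟩ - s.α ⟨0, by have := s.two_le; omega⟩ + (s.α (P v x) - s.α (P v y))

/-- Votes outside `M` do not change the score difference, so its total change is a sum over `M`. -/
theorem ScoringVector.score_sub_score (s : ScoringVector m) {P Q : V → Preference m}
    {M : Finset V} (hQ : ∀ v, v ∉ M → Q v = P v) (x y : Fin m) :
    s.score Q y - s.score Q x = s.score P y - s.score P x +
      ∑ v ∈ M, (s.α (Q v y) - s.α (Q v x) + (s.α (P v x) - s.α (P v y))) := by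
  have h : ∑ v ∈ M, (s.α (Q v y) - s.α (Q v x) + (s.α (P v x) - s.α (P v y))) =
      ∑ v, (s.α (Q v y) - s.α (Q v x) + (s.α (P v x) - s.α (P v y))) := by
    refine Finset.sum_subset (Finset.subset_univ M) fun v _ hv => ?_
    rw [hQ v hv]
    ring
  rw [h]
  simp only [score, Finset.sum_add_distrib, Finset.sum_sub_distrib]
  ring

/-- If `α₁ - α₂` is the smallest gap, then the score difference of two candidates in one vote is
at least `α₁ - α₂`. -/
theorem ScoringVector.FirstGapMinimal.le {s : ScoringVector m} (hs : s.FirstGapMinimal)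
    {i j : Fin m} (hij : i < j) :
    s.α ⟨0, by have := s.two_le; omega⟩ - s.α ⟨1, s.two_le⟩ ≤ s.α i - s.α j := by
  have hi : (i : ℕ) + 1 < m := by have := j.isLt; have : (i : ℕ) < j := hij; omega
  have h1 := hs i hi
  have h2 := s.antitone ⟨i + 1, hi⟩ j (by rw [Fin.le_def]; exact hij)
  have h3 : s.α ⟨i, by omega⟩ = s.α i := rfl
  rw [h3] at h1
  linarith

/-- Moving a candidate to the first position. -/
theorem exists_move_first (v : Preference m) (x : Fin m) :
    ∃ w : Preference m, (w x : ℕ) = 0 ∧ (∀ c, c ≠ x → v c ≤ w c) ∧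
      ∀ c, v c < v x → (w c : ℕ) = v c + 1 := by
  have : NeZero m := ⟨by have := x.isLt; omega⟩
  refine ⟨v.trans (Fin.cycleRange (v x)), ?_, ?_, ?_⟩
  · simp
  · intro c hc
    rcases lt_trichotomy (v c) (v x) with h | h | h
    · rw [Fin.le_def, Equiv.trans_apply, Fin.coe_cycleRange_of_lt h]
      omega
    · exact absurd (v.injective h) hc
    · rw [Equiv.trans_apply, Fin.cycleRange_of_gt h]
  · intro c h
    rw [Equiv.trans_apply, Fin.coe_cycleRange_of_lt h]

/-- A vote with `x` in the first and `y` in the second position, where no other candidate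
advances. -/
theorem exists_manipulated_vote (v : Preference m) {x y : Fin m} (hxy : y ≠ x) :
    ∃ w : Preference m, (w x : ℕ) = 0 ∧ (w y : ℕ) = 1 ∧ ∀ c, c ≠ x → c ≠ y → v c ≤ w c := by
  -- First `y` is moved to the top, then `x`; the second move pushes `y` down by exactly one.
  obtain ⟨u, h1, h2, -⟩ := exists_move_first v y
  obtain ⟨w, h3, h4, h5⟩ := exists_move_first u x
  refine ⟨w, h3, ?_, fun c hx hy => (h2 c hy).trans (h4 c hx)⟩
  rw [h5 y, h1]
  rw [Fin.lt_def, h1]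
  refine Nat.pos_of_ne_zero fun h => hxy (u.injective (Fin.ext ?_))
  rw [h1, h]

/-- The crux: beating `x` alone suffices, and the best vote of a manipulator depends neither on the
others nor on `M`. This makes the condition additive over the members. -/
theorem ScoringVector.FirstGapMinimal.isCoalitionAgainst_iff {s : ScoringVector m}
    (hs : s.FirstGapMinimal) (t : Preference m) (P : V → Preference m) (M : Finset V)
    {x y : Fin m} (hx : s.IsTop t P x) :
    IsCoalitionAgainst (s.winner t) P M y ↔ y ≠ x ∧
      (s.score P x - s.score P y ≤ ∑ v ∈ M, s.gain P x y v ∧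
        (s.score P x - s.score P y = ∑ v ∈ M, s.gain P x y v → t y ≤ t x)) := by
  classical
  rw [IsCoalitionAgainst, hx.winner_eq]
  refine and_congr_right fun hxy => ⟨?_, ?_⟩
  · rintro ⟨Q, hQ, hpref, hw⟩
    have htop := (s.isTop_winner t Q) x
    rw [hw] at htop
    have h1 := s.score_sub_score hQ x y
    have h2 : ∑ v ∈ M, (s.α (Q v y) - s.α (Q v x) + (s.α (P v x) - s.α (P v y))) ≤
        ∑ v ∈ M, s.gain P x y v := by
      refine Finset.sum_le_sum fun v hv => ?_
      -- Any admissible vote leaves `y` at least the first gap behind `x`, so `gain` is the largest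
      -- possible contribution of a voter.
      have := hs.le (hpref v hv)
      rw [gain]
      linarith
    refine ⟨by linarith [htop.1], fun he => htop.2 ?_⟩
    exact le_antisymm htop.1 (by linarith)
  · rintro ⟨h1, h2⟩
    choose w hw using fun v => exists_manipulated_vote (P v) hxy
    let Q : V → Preference m := fun v => if v ∈ M then w v else P v
    have hQ : ∀ v, v ∉ M → Q v = P v := fun v hv => if_neg hv
    have hQM : ∀ v, v ∈ M → Q v = w v := fun v hv => if_pos hv
    have hm := s.two_le
    refine ⟨Q, hQ, fun v hv => ?_, ?_⟩
    · rw [hQM v hv, Preference.Prefers, Fin.lt_def, (hw v).1, (hw v).2.1]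
      exact one_pos
    have h3 := s.score_sub_score hQ x y
    have h4 : ∑ v ∈ M, (s.α (Q v y) - s.α (Q v x) + (s.α (P v x) - s.α (P v y))) =
        ∑ v ∈ M, s.gain P x y v := by
      refine Finset.sum_congr rfl fun v hv => ?_
      have h5 : w v x = ⟨0, by omega⟩ := Fin.ext (hw v).1
      have h6 : w v y = ⟨1, hm⟩ := Fin.ext (hw v).2.1
      rw [hQM v hv, gain, h5, h6]
    have hxQ : s.score P x ≤ s.score Q x := by
      refine Finset.sum_le_sum fun v _ => ?_
      by_cases hv : v ∈ M
      · rw [hQM v hv]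
        exact s.antitone _ _ (by rw [Fin.le_def, (hw v).1]; exact Nat.zero_le _)
      · rw [hQ v hv]
    have hyQ : s.score Q x ≤ s.score Q y := by linarith
    have hty : s.score Q x = s.score Q y → t y ≤ t x := fun h => h2 (by linarith)
    refine IsTop.winner_eq fun c => ?_
    by_cases hcx : c = x
    · rw [hcx]
      exact ⟨hyQ, hty⟩
    by_cases hcy : c = y
    · rw [hcy]
      exact ⟨le_rfl, fun _ => le_rfl⟩
    have hcQ : s.score Q c ≤ s.score P c := by
      refine Finset.sum_le_sum fun v _ => ?_
      by_cases hv : v ∈ M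
      · rw [hQM v hv]
        exact s.antitone _ _ ((hw v).2.2 c hcx hcy)
      · rw [hQ v hv]
    obtain ⟨h7, h8⟩ := hx c
    -- The score of `c` in `Q` is at most that in `P`, then follow those of `x` in `P`, of `x` in
    -- `Q` and of `y` in `Q`. A tie of `c` with `y` forces equality throughout, and then `t y ≤ t x
    -- ≤ t c`.
    refine ⟨by linarith, fun he => (hty ?_).trans (h8 ?_)⟩ <;> apply le_antisymm <;> linarith

end

/-! ### The largest sum of `k` numbers -/

section

variable {V : Type} [Fintype V]

/-- A relaxation of the problem to choose at most `k` numbers with the largest sum. -/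
theorem sum_le_relaxation (g : V → ℚ) {k : ℕ} {M : Finset V} (hM : M.card ≤ k) {τ : ℚ}
    (hτ : 0 ≤ τ) : ∑ v ∈ M, g v ≤ k * τ + ∑ v, max (g v - τ) 0 := by
  have h1 : ∑ v ∈ M, max (g v - τ) 0 ≤ ∑ v, max (g v - τ) 0 :=
    Finset.sum_le_sum_of_subset_of_nonneg (Finset.subset_univ M) fun v _ _ => le_max_right _ _
  have h2 : ∑ v ∈ M, (g v - τ) ≤ ∑ v ∈ M, max (g v - τ) 0 :=
    Finset.sum_le_sum fun v _ => le_max_left _ _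
  rw [Finset.sum_sub_distrib, Finset.sum_const, nsmul_eq_mul] at h2
  have h3 : (M.card : ℚ) * τ ≤ k * τ := mul_le_mul_of_nonneg_right (by exact_mod_cast hM) hτ
  linarith

/-- Complementary slackness: `M` contains everything above `τ` and nothing below it, and `hk` says
that `M` has `k` elements or `τ = 0`. -/
theorem sum_eq_relaxation (g : V → ℚ) {k : ℕ} {M : Finset V} {τ : ℚ}
    (h1 : ∀ v, τ < g v → v ∈ M) (h2 : ∀ v ∈ M, τ ≤ g v) (hk : (M.card : ℚ) * τ = k * τ) :
    ∑ v ∈ M, g v = k * τ + ∑ v, max (g v - τ) 0 := by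
  have h3 : ∑ v ∈ M, max (g v - τ) 0 = ∑ v, max (g v - τ) 0 :=
    Finset.sum_subset (Finset.subset_univ M) fun v _ hv =>
      max_eq_right (sub_nonpos.2 (not_lt.1 fun h => hv (h1 v h)))
  have h4 : ∑ v ∈ M, max (g v - τ) 0 = ∑ v ∈ M, (g v - τ) :=
    Finset.sum_congr rfl fun v hv => max_eq_left (sub_nonneg.2 (h2 v hv))
  rw [← h3, h4, Finset.sum_sub_distrib, Finset.sum_const, nsmul_eq_mul, hk]
  ring

/-- The relaxation is exact for some threshold. -/
theorem exists_sum_eq_relaxation (g : V → ℚ) (k : ℕ) :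
    ∃ M : Finset V, M.card ≤ k ∧ ∃ τ, (τ = 0 ∨ ∃ v, g v = τ) ∧ 0 ≤ τ ∧
      ∑ v ∈ M, g v = k * τ + ∑ v, max (g v - τ) 0 := by
  classical
  let S : Finset ℚ := (insert 0 (Finset.univ.image g)).filter (0 ≤ ·)
  have h0 : (0 : ℚ) ∈ S := by simp [S]
  have hS : ∀ v, 0 ≤ g v → g v ∈ S := fun v hv => by simp [S, hv]
  -- The right threshold is the smallest candidate in `S` with at most `k` numbers strictly above
  -- it.
  let T : Finset ℚ := S.filter fun τ => (Finset.univ.filter fun v => τ < g v).card ≤ k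
  have hT : T.Nonempty := by
    refine ⟨S.max' ⟨0, h0⟩, Finset.mem_filter.2 ⟨Finset.max'_mem _ _, ?_⟩⟩
    rw [Finset.card_eq_zero.2]
    · exact Nat.zero_le k
    · refine Finset.filter_eq_empty_iff.2 fun v _ hv => ?_
      have h1 := Finset.le_max' S 0 h0
      exact absurd (Finset.le_max' S (g v) (hS v (h1.trans hv.le))) (not_le.2 hv)
  obtain ⟨hτS, hτk⟩ := Finset.mem_filter.1 (Finset.min'_mem T hT)
  have hmin : ∀ σ ∈ T, T.min' hT ≤ σ := fun σ hσ => Finset.min'_le T σ hσ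
  generalize T.min' hT = τ at hτS hτk hmin
  have hτ0 : 0 ≤ τ := (Finset.mem_filter.1 hτS).2
  have hτg : τ = 0 ∨ ∃ v, g v = τ := by simpa using (Finset.mem_filter.1 hτS).1
  rcases hτ0.eq_or_lt with h | h
  · refine ⟨Finset.univ.filter fun v => τ < g v, hτk, τ, hτg, hτ0,
      sum_eq_relaxation g (by simp) (fun v hv => (Finset.mem_filter.1 hv).2.le) ?_⟩
    rw [← h, mul_zero, mul_zero]
  -- Otherwise the next smaller candidate `σ` would also qualify: no number lies strictly between
  -- `σ` and `τ`, so fewer than `k` exceed `σ`.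
  · have hk : k ≤ (Finset.univ.filter fun v => τ ≤ g v).card := by
      by_contra! hlt
      have hne : (S.filter (· < τ)).Nonempty := ⟨0, Finset.mem_filter.2 ⟨h0, h⟩⟩
      obtain ⟨h1, h2⟩ := Finset.mem_filter.1 (Finset.max'_mem _ hne)
      have hmax : ∀ σ ∈ S.filter (· < τ), σ ≤ (S.filter (· < τ)).max' hne :=
        fun σ hσ => Finset.le_max' _ σ hσ
      generalize (S.filter (· < τ)).max' hne = σ at h1 h2 hmax
      refine absurd (hmin σ (Finset.mem_filter.2 ⟨h1, le_trans (Finset.card_le_card ?_) hlt.le⟩))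
        (not_le.2 h2)
      intro v hv
      rw [Finset.mem_filter] at hv ⊢
      refine ⟨hv.1, not_lt.1 fun h3 => absurd (hmax (g v) (Finset.mem_filter.2 ⟨?_, h3⟩))
        (not_le.2 hv.2)⟩
      exact hS v ((Finset.mem_filter.1 h1).2.trans hv.2.le)
    -- The numbers above `τ` are completed to exactly `k` members by some that equal `τ`.
    obtain ⟨M, hM1, hM2, hM3⟩ := Finset.exists_subsuperset_card_eq
      (s := Finset.univ.filter fun v => τ < g v) (t := Finset.univ.filter fun v => τ ≤ g v)
      (Finset.monotone_filter_right _ fun v _ hv => le_of_lt hv) hτk hk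
    refine ⟨M, hM3.le, τ, hτg, hτ0, sum_eq_relaxation g (fun v hv => hM1 (by simpa using hv))
      (fun v hv => (Finset.mem_filter.1 (hM2 hv)).2) (by rw [hM3])⟩

/-- Some sum of at most `k` numbers satisfies an upward closed condition if and only if all
relaxations do. -/
theorem exists_sum_iff_relaxation (g : V → ℚ) (k : ℕ) {p : ℚ → Prop}
    (hp : ∀ a b, a ≤ b → p a → p b) :
    (∃ M : Finset V, M.card ≤ k ∧ p (∑ v ∈ M, g v)) ↔
      ∀ τ, (τ = 0 ∨ ∃ v, g v = τ) → 0 ≤ τ → p (k * τ + ∑ v, max (g v - τ) 0) := by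
  constructor
  · rintro ⟨M, hM, h⟩ τ - hτ
    exact hp _ _ (sum_le_relaxation g hM hτ) h
  · intro h
    obtain ⟨M, hM, τ, h1, h2, h3⟩ := exists_sum_eq_relaxation g k
    exact ⟨M, hM, h3 ▸ h τ h1 h2⟩

end

/-! ### Correctness of the algorithm -/

section

/-- The candidates in the order of a vote. -/
def natRow {m : ℕ} (v : Preference m) : List ℕ := List.ofFn fun p => (v.symm p : ℕ)

theorem nats_rowOfPreference {m : ℕ} (v : Preference m) :
    nats ((rowOfPreference v).map ofInt) = natRow v := by
  simp [nats, rowOfPreference, natRow, ofInt, List.map_ofFn, Function.comp_def]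

theorem nodup_natRow {m : ℕ} (v : Preference m) : (natRow v).Nodup :=
  List.nodup_ofFn.2 fun _ _ h => v.symm.injective (Fin.ext h)

theorem mem_natRow {m : ℕ} (v : Preference m) (c : ℕ) : c ∈ natRow v ↔ ∃ d : Fin m, (d : ℕ) = c := by
  simp only [natRow, List.mem_ofFn]
  constructor
  · rintro ⟨p, h⟩
    exact ⟨_, h⟩
  · rintro ⟨d, h⟩
    exact ⟨v d, by rw [Equiv.symm_apply_apply, h]⟩

theorem length_natRow {m : ℕ} (v : Preference m) : (natRow v).length = m := List.length_ofFn

theorem natRow_getElem {m : ℕ} (v : Preference m) (c : Fin m)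
    (h : (v c : ℕ) < (natRow v).length) : (natRow v)[(v c : ℕ)] = c := by
  simp [natRow]

theorem before_iff (l : List ℕ) {a b : ℕ} (hb : b ∈ l) :
    before l a b = true ↔ l.idxOf a ≤ l.idxOf b := by
  induction l with
  | nil => simp at hb
  | cons z l ih =>
    have hc : before (z :: l) a b =
      bif natEq z a then true else bif natEq z b then false else before l a b := rfl
    rw [hc, List.idxOf_cons, List.idxOf_cons]
    by_cases h1 : z = a
    · rw [(natEq_iff z a).2 h1]
      simp [h1]
    · have h1' : natEq z a = false := by rwa [← Bool.not_eq_true, natEq_iff]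
      by_cases h2 : z = b
      · have h3 : (z == a) = false := by simpa using h1
        rw [h1', (natEq_iff z b).2 h2, h3]
        simp [h2]
      · have h2' : natEq z b = false := by rwa [← Bool.not_eq_true, natEq_iff]
        have h3 : (z == a) = false := by simpa using h1
        have h4 : (z == b) = false := by simpa using h2
        have h5 : b ∈ l := (List.mem_cons.1 hb).resolve_left fun h => h2 h.symm
        rw [h1', h2', h3, h4]
        simpa using ih h5

theorem before_natRow {m : ℕ} (t : Preference m) (a b : Fin m) :
    before (natRow t) a b = true ↔ t a ≤ t b := by
  have h : ∀ c : Fin m, (natRow t).idxOf (c : ℕ) = t c := by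
    intro c
    have hc : (t c : ℕ) < (natRow t).length := by rw [length_natRow]; exact (t c).isLt
    conv_lhs => rw [← natRow_getElem t c hc]
    exact (nodup_natRow t).idxOf_getElem _ hc
  rw [before_iff _ ((mem_natRow t b).2 ⟨b, rfl⟩), h, h, Fin.le_def]

theorem below_iff (w : Bool) (x y : Frac) :
    below w x y = true ↔ x.val ≤ y.val ∧ (x.val = y.val → w = true) := by
  cases w
  · have : below false x y = !(Frac.le y x) := rfl
    rw [this, Bool.not_eq_true', ← Bool.not_eq_true, Frac.le_iff, not_le]
    simp [lt_iff_le_and_ne]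
  · have : below true x y = Frac.le x y := rfl
    simp [this]

variable {m n : ℕ} {s : ScoringVector m} {A : List Frac} (hA : A.map Frac.val = List.ofFn s.α)
  (t : Preference m) (P : Fin n → Preference m)

include hA

theorem val_pointsOf (v : Preference m) (c : Fin m) :
    (pointsOf A c (natRow v)).val = s.α (v c) := by
  have hc : (v c : ℕ) < (natRow v).length := by rw [length_natRow]; exact (v c).isLt
  have hl : A.length = m := by simpa using congrArg List.length hA
  have hc' : (v c : ℕ) < A.length := by rw [hl]; exact (v c).isLt
  have h := lookup_getElem Frac.zero (natRow v) A (nodup_natRow v) (v c) hc hc'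
  rw [natRow_getElem v c hc] at h
  rw [pointsOf, h]
  have h1 : (A.map Frac.val)[(v c : ℕ)]'(by simpa using hc') = (A[(v c : ℕ)]).val := by simp
  rw [← h1]
  simp [hA]

theorem val_total (c : Fin m) :
    (total A (List.ofFn fun i => natRow (P i)) c).val = s.score P c := by
  rw [total, Frac.val_sum, List.map_ofFn, List.map_ofFn, List.sum_ofFn]
  exact Finset.sum_congr rfl fun i _ => val_pointsOf hA (P i) c

theorem val_gain (x y : Fin m) (i : Fin n) :
    (gain A x y (natRow (P i))).val = s.gain P x y i := by
  have hm := s.two_le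
  have hl : A.length = m := by simpa using congrArg List.length hA
  obtain ⟨a, b, A', rfl⟩ : ∃ a b A', A = a :: b :: A' := by
    match A, hl with
    | [], h => simp at h; omega
    | [a], h => simp at h; omega
    | a :: b :: A', _ => exact ⟨a, b, A', rfl⟩
  have h0 : a.val = s.α ⟨0, by omega⟩ := by
    have := congrArg (fun l => l[0]?) hA
    simpa [List.getElem?_ofFn, show 0 < m by omega] using this
  have h1 : b.val = s.α ⟨1, hm⟩ := by
    have := congrArg (fun l => l[1]?) hA
    simpa [List.getElem?_ofFn, show 1 < m by omega] using this
  simp only [gain, Frac.val_add, Frac.val_neg, val_pointsOf hA, ScoringVector.gain, List.tail_cons,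
    List.headD_cons, h0, h1]
  ring

theorem isWinner_iff (x : Fin m) :
    isWinner A (natRow t) (List.ofFn fun i => natRow (P i)) x = true ↔ s.IsTop t P x := by
  simp only [isWinner, List.all_eq_true, mem_natRow, forall_exists_index,
    forall_apply_eq_imp_iff, below_iff, val_total hA, before_natRow, ScoringVector.IsTop]

theorem canOvertake_iff (k : ℕ) (x y : Fin m) :
    canOvertake A (natRow t) (List.ofFn fun i => natRow (P i)) k x y = true ↔
      ∃ M : Finset (Fin n), M.card ≤ k ∧ s.score P x - s.score P y ≤ ∑ v ∈ M, s.gain P x y v ∧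
        (s.score P x - s.score P y = ∑ v ∈ M, s.gain P x y v → t y ≤ t x) := by
  rw [exists_sum_iff_relaxation (s.gain P x y) k (p := fun S => s.score P x - s.score P y ≤ S ∧
    (s.score P x - s.score P y = S → t y ≤ t x))]
  · have hr : ∀ τ : Frac, (relaxedSum k ((List.ofFn fun i => natRow (P i)).map
        fun v => gain A x y v) τ).val = k * τ.val + ∑ v, max (s.gain P x y v - τ.val) 0 := by
      intro τ
      rw [relaxedSum, Frac.val_add, Frac.val_smul, Frac.val_sum, List.map_ofFn, List.map_ofFn,
        List.map_ofFn, List.sum_ofFn]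
      congr 1
      refine Finset.sum_congr rfl fun i _ => ?_
      simp [val_gain hA, sub_eq_add_neg]
    have hτ : ∀ τ : Frac, ((!(Frac.le Frac.zero τ) ||
        below (before (natRow t) y x) (Frac.add (total A (List.ofFn fun i => natRow (P i)) x)
          (Frac.neg (total A (List.ofFn fun i => natRow (P i)) y)))
          (relaxedSum k ((List.ofFn fun i => natRow (P i)).map fun v => gain A x y v) τ)) = true ↔
        (0 ≤ τ.val → s.score P x - s.score P y ≤
            k * τ.val + ∑ v, max (s.gain P x y v - τ.val) 0 ∧
          (s.score P x - s.score P y = k * τ.val + ∑ v, max (s.gain P x y v - τ.val) 0 →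
            t y ≤ t x))) := by
      intro τ
      rw [Bool.or_eq_true, Bool.not_eq_true', ← Bool.not_eq_true, Frac.le_iff, Frac.val_zero,
        below_iff, hr, Frac.val_add, Frac.val_neg, val_total hA, val_total hA, before_natRow,
        ← sub_eq_add_neg]
      exact imp_iff_not_or.symm
    rw [canOvertake, List.all_eq_true]
    simp only [hτ]
    constructor
    · rintro h τ (rfl | ⟨v, rfl⟩)
      · have := h Frac.zero (by simp)
        rwa [Frac.val_zero] at this
      · have := h (gain A x y (natRow (P v)))
          (List.mem_cons_of_mem _ (List.mem_map.2 ⟨_, (List.mem_ofFn).2 ⟨v, rfl⟩, rfl⟩))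
        rwa [val_gain hA] at this
    · intro h τ hmem
      refine h τ.val ?_
      rcases List.mem_cons.1 hmem with rfl | h1
      · exact Or.inl Frac.val_zero
      · obtain ⟨r, hr1, rfl⟩ := List.mem_map.1 h1
        obtain ⟨v, rfl⟩ := (List.mem_ofFn).1 hr1
        exact Or.inr ⟨v, (val_gain hA P x y v).symm⟩
  -- The condition is upward closed in spite of the tie clause: if the larger sum equals the
  -- deficit, so does the smaller one.
  · rintro a b hab ⟨h1, h2⟩
    exact ⟨h1.trans hab, fun h => h2 (le_antisymm h1 (h ▸ hab))⟩

/-- The search over all candidates `x` finds only the winner, because `IsTop` determines it. -/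
theorem solveFor_iff (hs : s.FirstGapMinimal) (k : ℕ) (y : Fin m) :
    solveFor A (natRow t) (List.ofFn fun i => natRow (P i)) k y = true ↔
      ∃ M : Finset (Fin n), M.card ≤ k ∧ IsCoalitionAgainst (s.winner t) P M y := by
  have hw := s.isTop_winner t P
  simp only [hs.isCoalitionAgainst_iff t P _ hw]
  rw [solveFor, List.any_eq_true]
  constructor
  · rintro ⟨c, hc, h⟩
    obtain ⟨x, rfl⟩ := (mem_natRow t c).1 hc
    rw [Bool.and_eq_true, Bool.and_eq_true, isWinner_iff hA, canOvertake_iff hA, Bool.not_eq_true',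
      ← Bool.not_eq_true, natEq_iff] at h
    obtain ⟨h1, h2, M, h3, h4⟩ := h
    rw [h1.winner_eq]
    exact ⟨M, h3, fun he => h2 (congrArg Fin.val he.symm), h4⟩
  · rintro ⟨M, h1, h2, h3⟩
    refine ⟨s.winner t P, (mem_natRow t _).2 ⟨_, rfl⟩, ?_⟩
    rw [Bool.and_eq_true, Bool.and_eq_true, isWinner_iff hA, canOvertake_iff hA, Bool.not_eq_true',
      ← Bool.not_eq_true, natEq_iff]
    exact ⟨hw, fun h => h2 (Fin.ext h.symm), M, h1, h3⟩

end

/-! ### Correctness on written instances -/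

theorem map_val_fracs_rowOfScores {m : ℕ} (s : ScoringVector m) :
    (fracs ((rowOfScores s).map ofInt)).map Frac.val = List.ofFn s.α :=
  map_val_fracs _

theorem map_nats_profile {m n : ℕ} (P : Fin n → Preference m) :
    (((List.ofFn fun i => rowOfPreference (P i)).map (List.map ofInt)).map fun r => nats r) =
      List.ofFn fun i => natRow (P i) := by
  rw [List.map_ofFn, List.map_ofFn]
  exact congrArg List.ofFn (funext fun i => nats_rowOfPreference (P i))

theorem solveCPMSW_write (I : CPMSWInstance) : solveCPMSW I.write = true ↔ CPMSW I := by
  have h : solveCPMSW I.write = solveFor (fracs ((rowOfScores I.election.scores).map ofInt))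
      (nats ((rowOfPreference I.election.tie).map ofInt))
      (((List.ofFn fun i => rowOfPreference (I.election.profile i)).map (List.map ofInt)).map
        fun r => nats r) I.k (I.y : ℕ) := by
    rw [solveCPMSW, CPMSWInstance.write, parse_writeRows]
    rfl
  rw [h, nats_rowOfPreference, map_nats_profile,
    solveFor_iff (map_val_fracs_rowOfScores _) _ _ I.gap]
  rfl

theorem solveCPMS_write (I : CPMSInstance) : solveCPMS I.write = true ↔ CPMS I := by
  have h : solveCPMS I.write = (nats ((rowOfPreference I.election.tie).map ofInt)).any fun y =>
      solveFor (fracs ((rowOfScores I.election.scores).map ofInt))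
      (nats ((rowOfPreference I.election.tie).map ofInt))
      (((List.ofFn fun i => rowOfPreference (I.election.profile i)).map (List.map ofInt)).map
        fun r => nats r) I.k y := by
    rw [solveCPMS, CPMSInstance.write, parse_writeRows]
    rfl
  rw [h, nats_rowOfPreference, map_nats_profile, List.any_eq_true]
  simp only [mem_natRow]
  constructor
  · rintro ⟨_, ⟨y, rfl⟩, h1⟩
    obtain ⟨M, hM, h2⟩ := (solveFor_iff (map_val_fracs_rowOfScores _) _ _ I.gap _ _).1 h1
    exact ⟨M, hM, y, h2⟩
  · rintro ⟨M, hM, y, h2⟩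
    exact ⟨y, ⟨y, rfl⟩,
      (solveFor_iff (map_val_fracs_rowOfScores _) _ _ I.gap _ _).2 ⟨M, hM, h2⟩⟩

end Manipulation

theorem mainTheorem3 :
    Manipulation.InP Manipulation.cpmswEncoding Manipulation.CPMSW ∧
      Manipulation.InP Manipulation.cpmsEncoding Manipulation.CPMS := by
  exact ⟨Manipulation.inP_of_PT _ _ Manipulation.PT.solveCPMSW Manipulation.solveCPMSW_write,
    Manipulation.inP_of_PT _ _ Manipulation.PT.solveCPMS Manipulation.solveCPMS_write⟩
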